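/- For a finite simple graph $H$ without loops (the pattern graph), an instance of \textsc{Max Partial $H$-Coloring} is a pair $(G,\mathsf{rev})$ of a finite simple graph $G$ and a revenue function $\mathsf{rev}\colon V(G)\times V(H)\to\mathbb{R}$. A partial $H$-coloring of $G$ is a partial function $\phi\colon V(G)\rightharpoonup V(H)$ such that $\phi(u)\phi(v)\in E(H)$ for every edge $uv$ of $G$ with $u,v\in\mathrm{dom}\,\phi$; its revenue is $\sum_{u\in\mathrm{dom}\,\phi}\mathsf{rev}(u,\phi(u))$. Solving the instance means to output a partial $H$-coloring of maximum revenue. For $t\in\mathbb{N}$ let $S_t$ be the graph obtained from the star $K_{1,t}$ by subdividing every edge once, and let $P_6$ be the path on six vertices. A graph is $\mathcal{F}$-free if it has no induced subgraph isomorphic to a member of $\mathcal{F}$. Write $n=|V(G)|$, and let $\omega(G)$ be the maximum size of a clique in $G$. For every fixed $t\in\mathbb{N}$ and every fixed finite loopless graph $H$, \textsc{Max Partial $H$-Coloring} on $\{P_6,S_t\}$-free graphs $G$ can be solved in time $n^{\mathcal{O}(\omega(G)^t)}$. In particular, for every fixed finite loopless graph $H$, \textsc{Max Partial $H$-Coloring}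 on $\{P_6,\text{1-subdivided claw}\}$-free graphs $G$ can be solved in time $n^{\mathcal{O}(\omega(G)^3)}$, where the 1-subdivided claw is the graph obtained from $K_{1,3}$ by subdividing every edge once. Here "solvable in time $n^{\mathcal{O}(\omega(G)^t)}$" means that there are one algorithm and one constant $c$, depending only on $t$ and $H$, such that on every instance $(G,\mathsf{rev})$ with $G$ in the class the algorithm outputs an optimum solution after at most $c\cdot n^{c\,\omega(G)^t}+c$ elementary steps; an algorithm is a finite program (first-order recursive functions on cons cells and real numbers) in which each elementary operation, namely a pointer operation, a branch, a function call, or an addition, subtraction or comparison of two real numbers, costs one step, and whose only built-in real constants are $0$ and $1$. -/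

import Mathlib

namespace MaxPartial

/-! ### The problem -/

/-- A partial function `φ` from `V(G)` to `V(H)` (with `none` meaning "undefined") is a partial
`H`-coloring of `G` if it is a homomorphism to `H` from the subgraph of `G` induced by its
domain. -/
def IsPartialColoring {V W : Type*} (G : SimpleGraph V) (H : SimpleGraph W)
    (φ : V → Option W) : Prop :=
  ∀ u v : V, G.Adj u v → ∀ a b : W, φ u = some a → φ v = some b → H.Adj a b

/-- The revenue of a partial function: the sum of `rev u (φ u)` over the domain of `φ`. -/
noncomputable def revenue {V W : Type*} [Fintype V] (rev : V → W → ℝ) (φ : V → Option W) : ℝ :=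
  ∑ u, (φ u).elim 0 (rev u)

/-- `φ` is an optimum solution of the instance `(G, rev)` of Max Partial `H`-Coloring. -/
def IsOptimum {V W : Type*} [Fintype V] (G : SimpleGraph V) (H : SimpleGraph W)
    (rev : V → W → ℝ) (φ : V → Option W) : Prop :=
  IsPartialColoring G H φ ∧
    ∀ ψ : V → Option W, IsPartialColoring G H ψ → revenue rev ψ ≤ revenue rev φ

/-! ### The forbidden induced subgraphs -/

/-- The graph `S_t`, obtained from the star `K_{1,t}` by subdividing every edge once:
`none` is the center, `some (i, false)` is the subdivision vertex of the `i`-th edge and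
`some (i, true)` is the `i`-th leaf. -/
def subdividedStar (t : ℕ) : SimpleGraph (Option (Fin t × Bool)) :=
  SimpleGraph.fromRel fun x y =>
    ∃ i : Fin t, (x = none ∧ y = some (i, false)) ∨ (x = some (i, false) ∧ y = some (i, true))

/-- The 1-subdivided claw: center `0`, subdivision vertices `1, 2, 3`, leaves `4, 5, 6`. -/
def subdividedClaw : SimpleGraph (Fin 7) :=
  SimpleGraph.fromEdgeSet {s(0, 1), s(0, 2), s(0, 3), s(1, 4), s(2, 5), s(3, 6)}

/-! ### The model of computation

First-order recursive programs on cons cells and real numbers, with unit-cost primitives.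
A program is a finite list of unary, mutually recursive functions. The only operations on real
numbers are the constants `0` and `1`, addition, subtraction and comparison. Every program
uses environments of bounded length, so each counted step is a bounded number of
operations of a random access machine with real registers. -/

/-- Data: the empty cell, a real number, or an ordered pair. -/
inductive Val : Type
  | nil : Val
  | num : ℝ → Val
  | pair : Val → Val → Val

/-- Expressions; `var i` is the `i`-th most recently bound variable. -/
inductive Term : Type
  | var : ℕ → Term
  | nil : Term
  | zero : Term
  | one : Term
  | pair : Term → Term → Term
  | add : Term → Term → Term
  | sub : Term → Term → Term
  /-- `bind e e'` evaluates `e`, binds its value and evaluates `e'`. -/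
  | bind : Term → Term → Term
  /-- `casePair e e₁ e₂`: if the value of `e` is a pair, bind its second and then its first
  component and evaluate `e₁`; otherwise evaluate `e₂`. -/
  | casePair : Term → Term → Term → Term
  /-- `ifLe e e' e₁ e₂`: if the values of `e` and `e'` are numbers `x ≤ y`, evaluate `e₁`; if they
  are numbers with `y < x`, evaluate `e₂`. -/
  | ifLe : Term → Term → Term → Term → Term
  /-- `call f e` applies the `f`-th function of the program to the value of `e`. -/
  | call : ℕ → Term → Term

/-- A program: the list of the bodies of its functions. In a body, `var 0` is the argument. -/
abbrev Program : Type := List Term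

/-- `Eval P env e v T`: in the program `P` and the environment `env`, the evaluation of the
expression `e` terminates with the value `v` after exactly `T` steps. An ill-typed operation,
an unbound variable or a call to a function that does not exist has no value. -/
inductive Eval (P : Program) : List Val → Term → Val → ℕ → Prop
  | var {env : List Val} {i : ℕ} {v : Val} :
      env[i]? = some v → Eval P env (.var i) v 1
  | nil {env : List Val} : Eval P env .nil .nil 1
  | zero {env : List Val} : Eval P env .zero (.num 0) 1
  | one {env : List Val} : Eval P env .one (.num 1) 1
  | pair {env : List Val} {e e' : Term} {v v' : Val} {T T' : ℕ} :
      Eval P env e v T → Eval P env e' v' T' →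
      Eval P env (.pair e e') (.pair v v') (T + T' + 1)
  | add {env : List Val} {e e' : Term} {x y : ℝ} {T T' : ℕ} :
      Eval P env e (.num x) T → Eval P env e' (.num y) T' →
      Eval P env (.add e e') (.num (x + y)) (T + T' + 1)
  | sub {env : List Val} {e e' : Term} {x y : ℝ} {T T' : ℕ} :
      Eval P env e (.num x) T → Eval P env e' (.num y) T' →
      Eval P env (.sub e e') (.num (x - y)) (T + T' + 1)
  | bind {env : List Val} {e e' : Term} {v w : Val} {T T' : ℕ} :
      Eval P env e v T → Eval P (v :: env) e' w T' →
      Eval P env (.bind e e') w (T + T' + 1)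
  | casePair_pair {env : List Val} {e e₁ e₂ : Term} {a b w : Val} {T T' : ℕ} :
      Eval P env e (.pair a b) T → Eval P (a :: b :: env) e₁ w T' →
      Eval P env (.casePair e e₁ e₂) w (T + T' + 1)
  | casePair_else {env : List Val} {e e₁ e₂ : Term} {v w : Val} {T T' : ℕ} :
      Eval P env e v T → (∀ a b : Val, v ≠ .pair a b) → Eval P env e₂ w T' →
      Eval P env (.casePair e e₁ e₂) w (T + T' + 1)
  | ifLe_le {env : List Val} {e e' e₁ e₂ : Term} {x y : ℝ} {w : Val} {T T' T'' : ℕ} :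
      Eval P env e (.num x) T → Eval P env e' (.num y) T' → x ≤ y → Eval P env e₁ w T'' →
      Eval P env (.ifLe e e' e₁ e₂) w (T + T' + T'' + 1)
  | ifLe_gt {env : List Val} {e e' e₁ e₂ : Term} {x y : ℝ} {w : Val} {T T' T'' : ℕ} :
      Eval P env e (.num x) T → Eval P env e' (.num y) T' → y < x → Eval P env e₂ w T'' →
      Eval P env (.ifLe e e' e₁ e₂) w (T + T' + T'' + 1)
  | call {env : List Val} {f : ℕ} {e body : Term} {v w : Val} {T T' : ℕ} :
      Eval P env e v T → P[f]? = some body → Eval P [v] body w T' →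
      Eval P env (.call f e) w (T + T' + 1)

/-- Evaluation is deterministic: the value and the number of steps are determined. -/
theorem Eval.deterministic {P : Program} {env : List Val} {e : Term} {v v' : Val} {T T' : ℕ}
    (h : Eval P env e v T) (h' : Eval P env e v' T') : v = v' ∧ T = T' := by
  induction h generalizing v' T' with
  | var hi => cases h' with | var hi' => simp_all
  | nil => cases h'; simp
  | zero => cases h'; simp
  | one => cases h'; simp
  | pair _ _ ih₁ ih₂ =>
    cases h' with | pair g₁ g₂ => have := ih₁ g₁; have := ih₂ g₂; simp_all
  | add _ _ ih₁ ih₂ =>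
    cases h' with | add g₁ g₂ => have := ih₁ g₁; have := ih₂ g₂; simp_all
  | sub _ _ ih₁ ih₂ =>
    cases h' with | sub g₁ g₂ => have := ih₁ g₁; have := ih₂ g₂; simp_all
  | bind _ _ ih₁ ih₂ =>
    cases h' with
    | bind g₁ g₂ =>
      obtain ⟨rfl, rfl⟩ := ih₁ g₁
      obtain ⟨rfl, rfl⟩ := ih₂ g₂
      simp
  | casePair_pair _ _ ih₁ ih₂ =>
    cases h' with
    | casePair_pair g₁ g₂ =>
      obtain ⟨h, rfl⟩ := ih₁ g₁
      cases h
      obtain ⟨rfl, rfl⟩ := ih₂ g₂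
      simp
    | casePair_else g₁ g g₂ => exact absurd (ih₁ g₁).1.symm (g _ _)
  | casePair_else _ hn _ ih₁ ih₂ =>
    cases h' with
    | casePair_pair g₁ g₂ => exact absurd (ih₁ g₁).1 (hn _ _)
    | casePair_else g₁ g g₂ =>
      obtain ⟨rfl, rfl⟩ := ih₁ g₁
      obtain ⟨rfl, rfl⟩ := ih₂ g₂
      simp
  | ifLe_le _ _ hxy _ ih₁ ih₂ ih₃ =>
    cases h' with
    | ifLe_le g₁ g₂ g g₃ =>
      have := ih₁ g₁; have := ih₂ g₂; have := ih₃ g₃; simp_all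
    | ifLe_gt g₁ g₂ g g₃ =>
      have h₁ := (ih₁ g₁).1
      have h₂ := (ih₂ g₂).1
      simp only [Val.num.injEq] at h₁ h₂
      subst h₁ h₂
      exact absurd hxy (not_le.mpr g)
  | ifLe_gt _ _ hxy _ ih₁ ih₂ ih₃ =>
    cases h' with
    | ifLe_le g₁ g₂ g g₃ =>
      have h₁ := (ih₁ g₁).1
      have h₂ := (ih₂ g₂).1
      simp only [Val.num.injEq] at h₁ h₂
      subst h₁ h₂
      exact absurd g (not_le.mpr hxy)
    | ifLe_gt g₁ g₂ g g₃ =>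
      have := ih₁ g₁; have := ih₂ g₂; have := ih₃ g₃; simp_all
  | call _ hb _ ih₁ ih₂ =>
    cases h' with
    | call g₁ g g₂ =>
      obtain ⟨rfl, rfl⟩ := ih₁ g₁
      rw [hb] at g
      cases g
      obtain ⟨rfl, rfl⟩ := ih₂ g₂
      simp

/-- The program `P`, whose main function is the one of index `0`, outputs `v` on the input `x`
after `T` steps. -/
def Program.Outputs (P : Program) (x v : Val) (T : ℕ) : Prop :=
  Eval P [x] (.call 0 (.var 0)) v T

/-! ### Encodings of instances and solutions -/

/-- Lists are encoded as `nil`-terminated chains of pairs. -/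
def encodeList (l : List Val) : Val := l.foldr Val.pair Val.nil

/-- Truth values: `nil` for false, a pair for true. -/
noncomputable def encodeProp (p : Prop) : Val :=
  open Classical in if p then Val.pair Val.nil Val.nil else Val.nil

/-- Natural numbers in unary. -/
def encodeNat (m : ℕ) : Val := encodeList (List.replicate m Val.nil)

/-- An instance on the vertex set `{0, …, n - 1}`: the adjacency matrix of the graph and the
matrix of revenues, both by rows. -/
noncomputable def encodeInstance {n k : ℕ} (G : SimpleGraph (Fin n)) (rev : Fin n → Fin k → ℝ) :
    Val :=
  Val.pair
    (encodeList (List.ofFn fun u => encodeList (List.ofFn fun v => encodeProp (G.Adj u v))))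
    (encodeList (List.ofFn fun u => encodeList (List.ofFn fun a => Val.num (rev u a))))

/-- A partial coloring: the list over all vertices `u` of the number `0` if `φ u` is undefined,
and of the number `a + 1` if `φ u = a`. -/
def encodeColoring {n k : ℕ} (φ : Fin n → Option (Fin k)) : Val :=
  encodeList (List.ofFn fun u => encodeNat ((φ u).elim 0 fun a => (a : ℕ) + 1))

/-- `Solves P H 𝒢 B`: on every instance `(G, rev)` of Max Partial `H`-Coloring with `G` in the
class `𝒢`, the program `P` outputs an optimum solution within `B G` steps. -/
def Solves {k : ℕ} (P : Program) (H : SimpleGraph (Fin k))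
    (𝒢 : ∀ {n : ℕ}, SimpleGraph (Fin n) → Prop) (B : ∀ {n : ℕ}, SimpleGraph (Fin n) → ℕ) : Prop :=
  ∀ (n : ℕ) (G : SimpleGraph (Fin n)), 𝒢 G → ∀ rev : Fin n → Fin k → ℝ,
    ∃ (φ : Fin n → Option (Fin k)) (T : ℕ),
      P.Outputs (encodeInstance G rev) (encodeColoring φ) T ∧ IsOptimum G H rev φ ∧ T ≤ B G

end MaxPartial

/-! A partial coloring is viewed as a set of pairs (vertex, color), called items, no two of which
are in conflict (`Conf`) or share a vertex. The algorithm combines a Gyárfás path argument, which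
gives a shallow decomposition of `G`, with a bound on irredundant sets of items, which limits the
branching at each level.

Decomposition (`build_runs`). A disconnected vertex set is split into a component and the rest. A
connected one is split at a pivot `w` into neighbors and non-neighbors of `w`. Among the neighbors
the clique number is smaller by one. On the non-neighbors the next pivot of each component is taken
among the neighbors just removed, so consecutive pivots form an induced path, which `P₆`-freeness
stops at four vertices. Hence each branch of the tree has at most `4ω` pivots.

Branching (`branch_runs`). Let the items be split into `N` and `R`, and let `Y` be an optimum. A
smallest `I ⊆ Y ∩ N` in conflict with the same items of `R` as `Y ∩ N` is irredundant: each of its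
elements has a private conflicting item in `R` (`exists_isIrredundant`). Given `I`, drop from `R`
all that conflicts with `I`, and then from `N` all that conflicts with the remainder of `R`. Nothing
of `Y` is lost, and the two remainders are free of mutual conflicts, so they are solved
independently.

Size of `I` (`IsIrredundant.card_le`). For fixed colors of an item and its private item, the
vertices of the items together with `w` and an independent set of private vertices induce a
subdivided star. A Ramsey bound polynomial in `ω` then gives `|I| ≤ q = k² (t ω^t + 1)` in the
absence of `S_{t+1}`. At splits without edges across, `I` is empty.

So only pivots multiply the work, each by about `M^q` with `M` polynomial in `n`; the tree has
linear size, and the total is `n^O(ω^(t+1))` for `S_{t+1}` (`solve_runs`, `prog_runs`,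
`exists_time_bound`). -/

namespace MaxPartial

/-! ### Forbidden induced subgraphs -/

section Graphs

variable {V : Type*} {G : SimpleGraph V}

/-- The vertices of the list form an induced path, in this order. -/
def IsIndPath (G : SimpleGraph V) : List V → Prop
  | [] => True
  | [_] => True
  | w :: q :: l => G.Adj w q ∧ (∀ z ∈ l, ¬ G.Adj w z ∧ w ≠ z) ∧ IsIndPath G (q :: l)

theorem IsIndPath.pathGraph_six {a b c d e f : V} (h : IsIndPath G [a, b, c, d, e, f]) :
    (SimpleGraph.pathGraph 6).IsIndContained G := by
  simp only [IsIndPath, List.mem_cons, List.not_mem_nil, or_false, forall_eq_or_imp, forall_eq,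
    IsEmpty.forall_iff, implies_true, and_true] at h
  obtain ⟨hab, ⟨hac, had, hae, haf⟩, hbc, ⟨hbd, hbe, hbf⟩, hcd, ⟨hce, hcf⟩, hde, hdf, hef⟩ := h
  have hadj : ∀ i j : Fin 6, G.Adj (![a, b, c, d, e, f] i) (![a, b, c, d, e, f] j) ↔
      (SimpleGraph.pathGraph 6).Adj i j := by
    intro i j
    rw [SimpleGraph.pathGraph_adj]
    fin_cases i <;> fin_cases j <;> simp [G.adj_comm, *]
  have hinj : Function.Injective ![a, b, c, d, e, f] := by
    intro i j hij
    fin_cases i <;> fin_cases j <;> first | rfl | (exfalso; simp at hij; subst hij; simp_all)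
  exact ⟨⟨⟨_, hinj⟩, hadj _ _⟩⟩

/-- Distinctness of the `x i` and of the `u i` is not assumed, since `hxu` already separates
different indices. In contrast, `hwu` cannot be dropped: for `t = 1` the other hypotheses allow `u 0
= w`. -/
theorem subdividedStar_isIndContained {t : ℕ} {w : V} {x u : Fin t → V}
    (hx : ∀ i, G.Adj w (x i)) (hu : ∀ i, ¬ G.Adj w (u i)) (hwu : ∀ i, w ≠ u i)
    (hxx : ∀ i j, ¬ G.Adj (x i) (x j)) (huu : ∀ i j, ¬ G.Adj (u i) (u j))
    (hxu : ∀ i j, G.Adj (x i) (u j) ↔ i = j) :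
    (subdividedStar t).IsIndContained G := by
  let e : Option (Fin t × Bool) → V := fun o => o.elim w fun p => if p.2 then u p.1 else x p.1
  have hux : ∀ i j, G.Adj (u i) (x j) ↔ i = j := fun i j => by
    rw [G.adj_comm, hxu, eq_comm]
  have hadj : ∀ a b, G.Adj (e a) (e b) ↔ (subdividedStar t).Adj a b := by
    have hxw : ∀ i, G.Adj (x i) w := fun i => (hx i).symm
    have huw : ∀ i, ¬ G.Adj (u i) w := fun i h => hu i h.symm
    rintro (_ | ⟨i, _ | _⟩) (_ | ⟨j, _ | _⟩) <;>
      simp [e, subdividedStar, hx, hu, hxx, huu, hxu, hux, hxw, huw]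
    exact eq_comm
  have hinj : Function.Injective e := by
    have hxu' : ∀ i j, x i ≠ u j := fun i j h => hu j (h ▸ hx i)
    rintro (_ | ⟨i, _ | _⟩) (_ | ⟨j, _ | _⟩) h <;> simp only [e, Option.elim, if_true, if_false,
      Bool.false_eq_true] at h
    · rfl
    · exact absurd h (hx j).ne
    · exact absurd h (hwu j)
    · exact absurd h.symm (hx i).ne
    · have := (hxu i i).2 rfl
      rw [h, hxu] at this
      simp [this]
    · exact absurd h (hxu' _ _)
    · exact absurd h.symm (hwu i)
    · exact absurd h.symm (hxu' _ _)
    · have := (hxu i i).2 rfl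
      rw [h, hxu] at this
      simp [this]
  exact ⟨⟨⟨e, hinj⟩, hadj _ _⟩⟩

theorem subdividedClaw_isIndContained_subdividedStar :
    subdividedClaw.IsIndContained (subdividedStar 3) := by
  refine ⟨⟨⟨![none, some (0, false), some (1, false), some (2, false), some (0, true),
    some (1, true), some (2, true)], by decide⟩, ?_⟩⟩
  intro a b
  simp only [Function.Embedding.coeFn_mk, subdividedClaw, subdividedStar]
  fin_cases a <;> fin_cases b <;> simp

/-- Ramsey's theorem with a polynomial bound in the clique number. -/
theorem card_le_of_clique_of_indep (ω : ℕ) : ∀ (t : ℕ) (U : Finset V),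
    (∀ K ⊆ U, G.IsClique (K : Set V) → K.card ≤ ω) →
    (∀ J ⊆ U, G.IsIndepSet (J : Set V) → J.card ≤ t) → U.card ≤ t * ω ^ t := by
  classical
  intro t
  induction t with
  | zero =>
    intro U _ hJ
    by_contra! h
    obtain ⟨v, hv⟩ : U.Nonempty := Finset.card_pos.1 (by omega)
    have := hJ {v} (by simpa using hv) (by simp [SimpleGraph.IsIndepSet])
    simp at this
  | succ t ih =>
    intro U hK hJ
    obtain ⟨K, hKm, hmax⟩ := (U.powerset.filter fun K : Finset V => G.IsClique (K : Set V)).exists_max_image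
      Finset.card ⟨∅, by simp⟩
    simp only [Finset.mem_filter, Finset.mem_powerset] at hKm hmax
    -- No vertex outside a maximum clique `K` is adjacent to all of `K`, so `U` is covered by at
    -- most `ω` sets, each a vertex of `K` with its non-neighbors.
    have hsub : U ⊆ K.biUnion fun x => insert x (U.filter fun v => v ≠ x ∧ ¬ G.Adj x v) := by
      intro v hv
      simp only [Finset.mem_biUnion, Finset.mem_insert, Finset.mem_filter]
      by_cases hvK : v ∈ K
      · exact ⟨v, hvK, Or.inl rfl⟩
      · by_contra! hcon
        have := hmax (insert v K) ⟨Finset.insert_subset hv hKm.1, by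
          rw [Finset.coe_insert]
          refine hKm.2.insert fun b hb hne => ((hcon b hb).2 hv hne).symm⟩
        rw [Finset.card_insert_of_notMem hvK] at this
        omega
    have hx : ∀ x ∈ K, (insert x (U.filter fun v => v ≠ x ∧ ¬ G.Adj x v)).card ≤
        t * ω ^ t + 1 := by
      intro x hx
      refine (Finset.card_insert_le _ _).trans (Nat.succ_le_succ (ih _
        (fun L hL => hK L (hL.trans (Finset.filter_subset _ _))) fun J hJs hJi => ?_))
      have hxJ : x ∉ J := fun h => by simpa using hJs h
      -- An independent set of non-neighbors of `x` stays independent when `x` is added, so the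
      -- independence bound drops by one.
      have := hJ (insert x J) (Finset.insert_subset (hKm.1 hx)
        (hJs.trans (Finset.filter_subset _ _))) (by
          rw [Finset.coe_insert]
          refine Set.Pairwise.insert hJi fun b hb _ => ?_
          have := (Finset.mem_filter.1 (hJs hb)).2.2
          exact ⟨this, fun h => this h.symm⟩)
      rw [Finset.card_insert_of_notMem hxJ] at this
      omega
    have h1 := (Finset.card_le_card hsub).trans (Finset.card_biUnion_le_card_mul _ _ _ hx)
    have h2 := hK K hKm.1 hKm.2
    have h3 : ω ≤ ω ^ (t + 1) := Nat.le_self_pow (by omega) ω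
    calc U.card ≤ ω * (t * ω ^ t + 1) := h1.trans (Nat.mul_le_mul_right _ h2)
      _ = t * ω ^ (t + 1) + ω := by ring
      _ ≤ _ := by linarith

/-! ### Decomposition trees -/

/-- A hierarchical bipartition of the vertices: `node B l r` separates the vertices in `B` from
those that are not in `B`. -/
inductive Dec (V : Type*)
  | leaf : Dec V
  | node : List V → Dec V → Dec V → Dec V

/-- The number of internal nodes. -/
def Dec.size : Dec V → ℕ
  | leaf => 0
  | node _ l r => l.size + r.size + 1

/-- `T` decomposes the set `A` down to single vertices; every bipartition has no edges across, or
separates the neighbors of some vertex from the others, the latter at most `d` times along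
every branch. -/
inductive Dec.Ok (G : SimpleGraph V) : Dec V → Set V → ℕ → Prop
  | leaf {A : Set V} {d : ℕ} : A.Subsingleton → Ok G .leaf A d
  | split {B : List V} {l r : Dec V} {A : Set V} {d : ℕ} : B.Nodup →
      (∀ u ∈ A, u ∈ B → ∀ v ∈ A, v ∉ B → ¬ G.Adj u v) →
      Ok G l {v ∈ A | v ∈ B} d → Ok G r {v ∈ A | v ∉ B} d → Ok G (.node B l r) A d
  | pivot {B : List V} {l r : Dec V} {A : Set V} {d : ℕ} (w : V) : B.Nodup →
      (∀ v ∈ A, v ∈ B ↔ G.Adj w v) →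
      Ok G l {v ∈ A | v ∈ B} d → Ok G r {v ∈ A | v ∉ B} d → Ok G (.node B l r) A (d + 1)

theorem Dec.Ok.anti {T : Dec V} {A : Set V} {d : ℕ} (h : T.Ok G A d) :
    ∀ {A' : Set V} {d' : ℕ}, A' ⊆ A → d ≤ d' → T.Ok G A' d' := by
  induction h with
  | leaf h => exact fun hA _ => .leaf (h.anti hA)
  | split hB h _ _ ih₁ ih₂ =>
    exact fun hA hd => .split hB (fun u hu huB v hv => h u (hA hu) huB v (hA hv))
      (ih₁ (fun v hv => ⟨hA hv.1, hv.2⟩) hd) (ih₂ (fun v hv => ⟨hA hv.1, hv.2⟩) hd)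
  | pivot w hB h _ _ ih₁ ih₂ =>
    intro A' d' hA hd
    obtain ⟨d', rfl⟩ : ∃ e, d' = e + 1 := ⟨d' - 1, by omega⟩
    exact .pivot w hB (fun v hv => h v (hA hv)) (ih₁ (fun v hv => ⟨hA hv.1, hv.2⟩) (by omega))
      (ih₂ (fun v hv => ⟨hA hv.1, hv.2⟩) (by omega))

/-- There is no bipartition of `A` without edges across. -/
def IsLinked (G : SimpleGraph V) (A : Set V) : Prop :=
  ∀ B ⊆ A, B.Nonempty → (∀ u ∈ B, ∀ v ∈ A, v ∉ B → ¬ G.Adj u v) → B = A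

/-- A nonempty closed subset contains a point of `A`, since a point of `Y` brings along its neighbor
in `A`. Hence it contains all of `A`, and then all of `Y`. -/
theorem IsLinked.union {A Y : Set V} (h : IsLinked G A)
    (hY : ∀ y ∈ Y, ∃ x ∈ A, G.Adj x y) : IsLinked G (A ∪ Y) := by
  intro B hB hne hcl
  have key : (B ∩ A).Nonempty → B = A ∪ Y := by
    intro hBA
    have hA := h (B ∩ A) Set.inter_subset_right hBA fun u hu v hv hvB =>
      hcl u hu.1 v (Or.inl hv) fun hv' => hvB ⟨hv', hv⟩
    have hAB : A ⊆ B := hA ▸ Set.inter_subset_left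
    refine hB.antisymm (Set.union_subset hAB fun y hy => ?_)
    by_contra hyB
    obtain ⟨x, hx, hxy⟩ := hY y hy
    exact hcl x (hAB hx) y (Or.inr hy) hyB hxy
  obtain ⟨b, hb⟩ := hne
  by_cases hbA : b ∈ A
  · exact key ⟨b, hb, hbA⟩
  · obtain ⟨x, hx, hxb⟩ := hY b ((hB hb).resolve_left hbA)
    by_cases hxB : x ∈ B
    · exact key ⟨x, hxB, hx⟩
    · exact absurd hxb.symm (hcl b hb x (Or.inl hx) hxB)

theorem IsLinked.exists_adj {A : Set V} (h : IsLinked G A) {v u : V} (hv : v ∈ A) (hu : u ∈ A)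
    (hne : u ≠ v) : ∃ x ∈ A, G.Adj v x := by
  by_contra! hcon
  have := h {v} (by simpa using hv) ⟨v, rfl⟩ (by
    rintro _ rfl x hx _
    exact hcon x hx)
  rw [← this] at hu
  exact hne hu

/-! ### The conflict relation on pairs of a vertex and a color -/

variable {W : Type*} {H : SimpleGraph W}

/-- The pairs of vertex and color `x` and `y`, on different vertices, exclude each other. -/
def Conf (G : SimpleGraph V) (H : SimpleGraph W) (x y : V × W) : Prop :=
  G.Adj x.1 y.1 ∧ ¬ H.Adj x.2 y.2

theorem Conf.symm {x y : V × W} (h : Conf G H x y) : Conf G H y x :=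
  ⟨h.1.symm, fun h' => h.2 h'.symm⟩

theorem not_conf_self (x : V × W) : ¬ Conf G H x x := fun h => G.irrefl h.1

/-- `Y` is the graph of a partial coloring. -/
def IsValid (G : SimpleGraph V) (H : SimpleGraph W) (Y : Set (V × W)) : Prop :=
  (∀ x ∈ Y, ∀ y ∈ Y, ¬ Conf G H x y) ∧ ∀ x ∈ Y, ∀ y ∈ Y, x.1 = y.1 → x = y

theorem IsValid.anti {X Y : Set (V × W)} (h : IsValid G H Y) (hX : X ⊆ Y) : IsValid G H X :=
  ⟨fun x hx y hy => h.1 x (hX hx) y (hX hy), fun x hx y hy => h.2 x (hX hx) y (hX hy)⟩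

/-- `I` is an independent subset of `N` each of whose elements has a private neighbor in `R`. -/
structure IsIrredundant (G : SimpleGraph V) (H : SimpleGraph W) (N R I : Set (V × W)) : Prop where
  subset : I ⊆ N
  indep : ∀ x ∈ I, ∀ y ∈ I, ¬ Conf G H x y
  private_nbr : ∀ x ∈ I, ∃ r ∈ R, Conf G H x r ∧ ∀ y ∈ I, y ≠ x → ¬ Conf G H y r

theorem IsIrredundant.anti {N R I J : Set (V × W)} (h : IsIrredundant G H N R J) (hI : I ⊆ J) :
    IsIrredundant G H N R I where
  subset := hI.trans h.subset
  indep x hx y hy := h.indep x (hI hx) y (hI hy)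
  private_nbr x hx := by
    obtain ⟨r, hr, hxr, hp⟩ := h.private_nbr x (hI hx)
    exact ⟨r, hr, hxr, fun y hy => hp y (hI hy)⟩

/-- Among the subsets of `J` that dominate the same part of `R`, one of minimum size works: an
element without a private neighbor could be erased. -/
theorem exists_isIrredundant {N R : Set (V × W)} (J : Finset (V × W)) (hJN : ∀ x ∈ J, x ∈ N)
    (hJ : ∀ x ∈ J, ∀ y ∈ J, ¬ Conf G H x y) :
    ∃ I ⊆ J, IsIrredundant G H N R (I : Set (V × W)) ∧
      ∀ r ∈ R, (∃ x ∈ J, Conf G H x r) → ∃ x ∈ I, Conf G H x r := by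
  classical
  obtain ⟨I, hI, hmin⟩ := (J.powerset.filter fun I : Finset (V × W) =>
    ∀ r ∈ R, (∃ x ∈ J, Conf G H x r) → ∃ x ∈ I, Conf G H x r).exists_min_image Finset.card
    ⟨J, Finset.mem_filter.2 ⟨Finset.mem_powerset_self J, fun _ _ h => h⟩⟩
  simp only [Finset.mem_filter, Finset.mem_powerset] at hI hmin
  refine ⟨I, hI.1, ⟨fun x hx => hJN x (hI.1 hx),
    fun x hx y hy => hJ x (hI.1 hx) y (hI.1 hy), fun x hx => ?_⟩, hI.2⟩
  rw [Finset.mem_coe] at hx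
  by_contra! hcon
  have := hmin (I.erase x) ⟨(Finset.erase_subset _ _).trans hI.1, fun r hr hJr => by
    obtain ⟨y, hy, hyr⟩ := hI.2 r hr hJr
    by_cases hyx : y = x
    · subst hyx
      obtain ⟨z, hz, hzy, hzr⟩ := hcon r hr hyr
      exact ⟨z, Finset.mem_erase.2 ⟨hzy, hz⟩, hzr⟩
    · exact ⟨y, Finset.mem_erase.2 ⟨hyx, hy⟩, hyr⟩⟩
  have := Finset.card_erase_lt_of_mem hx
  omega

/-- Items of one color without conflict lie on pairwise non-adjacent vertices, because `H` has no
loops. With the two colors fixed, conflict with a private item is plain adjacency, so `t + 1`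
independent private vertices would complete an induced subdivided star centered at `w`. Ramsey's
theorem bounds each color class. -/
theorem IsIrredundant.card_le [Fintype W] {t ω : ℕ}
    (hstar : ¬ (subdividedStar (t + 1)).IsIndContained G)
    (hω : ∀ K : Finset V, G.IsClique (K : Set V) → K.card ≤ ω) {w : V} {N R : Set (V × W)}
    (hN : ∀ x ∈ N, G.Adj w x.1) (hR : ∀ x ∈ R, ¬ G.Adj w x.1) {I : Finset (V × W)}
    (hI : IsIrredundant G H N R (I : Set (V × W))) :
    I.card ≤ Fintype.card W ^ 2 * (t * ω ^ t + 1) := by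
  classical
  choose! f hfR hf hfp using hI.private_nbr
  have h1 := Finset.card_le_mul_card_image_of_maps_to (s := I)
    (t := (Finset.univ : Finset (W × W))) (f := fun x => (x.2, (f x).2))
    (fun _ _ => Finset.mem_univ _) (t * ω ^ t + 1) ?_
  · rw [Finset.card_univ, Fintype.card_prod] at h1
    linarith
  rintro ⟨a, b⟩ -
  set F := I.filter fun x => (x.2, (f x).2) = (a, b) with hFdef
  have hF : ∀ x ∈ F, x ∈ I ∧ x.2 = a ∧ (f x).2 = b := by simp [hFdef]
  -- The `+ 1` in the bound pays for singleton classes, where the private vertex may be `w` itself.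
  by_cases hF1 : F.card ≤ 1
  · omega
  have hab : ¬ H.Adj a b := by
    obtain ⟨x, hx⟩ : F.Nonempty := Finset.card_pos.1 (by omega)
    obtain ⟨hxI, rfl, rfl⟩ := hF x hx
    exact (hf x hxI).2
  have hxy : ∀ x ∈ F, ∀ y ∈ F, G.Adj x.1 (f y).1 ↔ x = y := by
    intro x hx y hy
    obtain ⟨hxI, hxa, -⟩ := hF x hx
    obtain ⟨hyI, -, hyb⟩ := hF y hy
    refine ⟨fun h => ?_, fun h => h ▸ (hf x hxI).1⟩
    by_contra hne
    exact hfp y hyI x hxI hne ⟨h, by rwa [hxa, hyb]⟩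
  have hinj : Set.InjOn (fun x => (f x).1) (F : Set (V × W)) := fun x hx y hy h => by
    have h' : (f x).1 = (f y).1 := h
    rw [← hxy x hx y hy, ← h', hxy x hx x hx]
  have hw : ∀ x ∈ F, w ≠ (f x).1 := by
    intro x hx hwx
    -- A second element `y` of the class is adjacent to `w`, so `w` cannot be private to `x`.
    obtain ⟨y, hy, hne⟩ := Finset.exists_mem_ne (s := F) (by omega) x
    refine hne ((hxy y hy x hx).1 ?_)
    rw [← hwx]
    exact (hN y (hI.subset (hF y hy).1)).symm
  rw [← Finset.card_image_of_injOn hinj]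
  refine (card_le_of_clique_of_indep (G := G) ω t _ (fun K _ => hω K) fun J hJ hJi => ?_).trans
    (Nat.le_succ _)
  by_contra! hcard
  obtain ⟨J', hJ', hcard'⟩ := Finset.exists_subset_card_eq hcard
  let e := (J'.equivFinOfCardEq hcard').symm
  have hpre : ∀ i, ∃ x ∈ F, (f x).1 = (e i : V) := fun i => by
    simpa using hJ (hJ' (e i).2)
  choose x hxF hx using hpre
  refine hstar (subdividedStar_isIndContained (w := w) (x := fun i => (x i).1)
    (u := fun i => e i) (fun i => hN _ (hI.subset (hF _ (hxF i)).1)) (fun i => ?_) (fun i => ?_)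
    (fun i j h => ?_) (fun i j h => ?_) (fun i j => ?_))
  · rw [← hx]
    exact hR _ (hfR _ (hF _ (hxF i)).1)
  · rw [← hx]
    exact hw _ (hxF i)
  · have hi := hF _ (hxF i)
    have hj := hF _ (hxF j)
    exact hI.indep _ hi.1 _ hj.1 ⟨h, by rw [hi.2.1, hj.2.1]; exact H.irrefl⟩
  · by_cases hij : i = j
    · subst hij
      exact G.irrefl h
    · exact hJi (hJ' (e i).2) (hJ' (e j).2) h.ne h
  · rw [← hx, hxy _ (hxF i) _ (hxF j)]
    refine ⟨fun h => ?_, fun h => h ▸ rfl⟩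
    have h2 : (e i : V) = e j := by rw [← hx, ← hx, h]
    exact e.injective (Subtype.ext h2)

end Graphs

/-! ### Running programs within a number of steps -/

/-- The evaluation of `e` terminates with the value `v` after at most `B` steps. -/
def Runs (P : Program) (env : List Val) (e : Term) (v : Val) (B : ℕ) : Prop :=
  ∃ T ≤ B, Eval P env e v T

namespace Runs

variable {P : Program} {env : List Val} {e e' e₁ e₂ body : Term} {v v' w a b : Val}
  {B B' B'' : ℕ} {x y : ℝ}

theorem mono (h : Runs P env e v B) (hB : B ≤ B') : Runs P env e v B' :=
  let ⟨T, hT, h⟩ := h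
  ⟨T, hT.trans hB, h⟩

theorem var {i : ℕ} (h : env[i]? = some v) : Runs P env (.var i) v 1 := ⟨1, le_rfl, .var h⟩

theorem nil : Runs P env .nil .nil 1 := ⟨1, le_rfl, .nil⟩

theorem zero : Runs P env .zero (.num 0) 1 := ⟨1, le_rfl, .zero⟩

theorem pair (h : Runs P env e v B) (h' : Runs P env e' v' B') :
    Runs P env (.pair e e') (.pair v v') (B + B' + 1) :=
  let ⟨_, hT, h⟩ := h
  let ⟨_, hT', h'⟩ := h'
  ⟨_, by omega, .pair h h'⟩

theorem add (h : Runs P env e (.num x) B) (h' : Runs P env e' (.num y) B') :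
    Runs P env (.add e e') (.num (x + y)) (B + B' + 1) :=
  let ⟨_, hT, h⟩ := h
  let ⟨_, hT', h'⟩ := h'
  ⟨_, by omega, .add h h'⟩

theorem bind (h : Runs P env e v B) (h' : Runs P (v :: env) e' w B') :
    Runs P env (.bind e e') w (B + B' + 1) :=
  let ⟨_, hT, h⟩ := h
  let ⟨_, hT', h'⟩ := h'
  ⟨_, by omega, .bind h h'⟩

theorem casePair (h : Runs P env e (.pair a b) B) (h' : Runs P (a :: b :: env) e₁ w B') :
    Runs P env (.casePair e e₁ e₂) w (B + B' + 1) :=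
  let ⟨_, hT, h⟩ := h
  let ⟨_, hT', h'⟩ := h'
  ⟨_, by omega, .casePair_pair h h'⟩

theorem caseNil (h : Runs P env e .nil B) (h' : Runs P env e₂ w B') :
    Runs P env (.casePair e e₁ e₂) w (B + B' + 1) :=
  let ⟨_, hT, h⟩ := h
  let ⟨_, hT', h'⟩ := h'
  ⟨_, by omega, .casePair_else h nofun h'⟩

/-- Truth is encoded as a pair of two `nil`s, so the positive branch runs with two additional
bindings and shifted variable indices. -/
theorem caseProp {p : Prop} (h : Runs P env e (encodeProp p) B)
    (h₁ : p → Runs P (.nil :: .nil :: env) e₁ w B') (h₂ : ¬ p → Runs P env e₂ w B') :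
    Runs P env (.casePair e e₁ e₂) w (B + B' + 1) := by
  by_cases hp : p
  · exact casePair (by simpa [encodeProp, hp] using h) (h₁ hp)
  · exact caseNil (by simpa [encodeProp, hp] using h) (h₂ hp)

theorem ifLe (h : Runs P env e (.num x) B) (h' : Runs P env e' (.num y) B')
    (h₁ : x ≤ y → Runs P env e₁ w B'') (h₂ : y < x → Runs P env e₂ w B'') :
    Runs P env (.ifLe e e' e₁ e₂) w (B + B' + B'' + 1) := by
  obtain ⟨_, hT, h⟩ := h
  obtain ⟨_, hT', h'⟩ := h'
  rcases le_or_gt x y with hxy | hxy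
  · obtain ⟨_, hT'', h''⟩ := h₁ hxy
    exact ⟨_, by omega, .ifLe_le h h' hxy h''⟩
  · obtain ⟨_, hT'', h''⟩ := h₂ hxy
    exact ⟨_, by omega, .ifLe_gt h h' hxy h''⟩

theorem call {f : ℕ} (h : Runs P env e v B) (hb : P[f]? = some body)
    (h' : Runs P [v] body w B') : Runs P env (.call f e) w (B + B' + 1) :=
  let ⟨_, hT, h⟩ := h
  let ⟨_, hT', h'⟩ := h'
  ⟨_, by omega, .call h hb h'⟩

end Runs

/-! ### The program -/

section Bodies

open Term

/-- The constant list with the given entries. -/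
def Term.list (l : List Term) : Term := l.foldr Term.pair Term.nil

/-- The constant truth value true. -/
def Term.true : Term := pair nil nil

/-- The constant truth value of `p`. -/
noncomputable def Term.ofProp (p : Prop) : Term :=
  open Classical in if p then Term.true else nil

/-- `(l, i) ↦ l[i]` -/
def nthBody : Term :=
  casePair (var 0)
    (casePair (var 0)
      (casePair (var 3) (call 1 (pair (var 3) (var 1))) (var 0))
      nil)
    nil

/-- `(i, j) ↦ (i = j)` for unary numbers. -/
def eqnBody : Term :=
  casePair (var 0)
    (casePair (var 0)
      (casePair (var 3) (call 2 (pair (var 3) (var 1))) nil)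
      (casePair (var 1) nil Term.true))
    nil

/-- `(c, x, y)` is mapped to one of three relations between the records `x` and `y`,
selected by `c`: adjacent vertices, conflict, same vertex. -/
def relBody : Term :=
  casePair (var 0) (casePair (var 1) (casePair (var 0) (casePair (var 3)
    (casePair (var 2) (casePair (var 2)
      -- Here `var 10` is the code `c`. If `c` is `nil`, only the adjacency row is consulted; if it
      -- is a pair, its first component decides between comparing vertex numbers (a pair) and
      -- testing conflict (`nil`).
      (casePair (var 10)
        (casePair (var 0)
          (call 2 (pair (var 6) (var 4)))
          (casePair (call 1 (pair (var 5) (var 2)))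
            (casePair (var 11)
              (casePair (var 1)
                (casePair (var 13) (call 1 (pair (var 2) (var 0))) nil)
                nil)
              nil)
            nil))
        (call 1 (pair (var 3) (var 0))))
      nil) nil) nil) nil) nil) nil

/-- `(c, X, u)` is mapped to whether `u` is related to an element of `X`. -/
def anyBody : Term :=
  casePair (var 0) (casePair (var 1) (casePair (var 0)
    (casePair (call 3 (pair (var 4) (pair (var 0) (var 3))))
      Term.true
      (call 4 (pair (var 4) (pair (var 1) (var 3)))))
    nil) nil) nil

/-- `(c, X, U)` is mapped to the lists of those elements of `U` that are related to an element of
`X` and of those that are not. -/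
def partBody : Term :=
  casePair (var 0) (casePair (var 1) (casePair (var 1)
    (casePair (call 5 (pair (var 4) (pair (var 2) (var 1))))
      (casePair (call 4 (pair (var 6) (pair (var 4) (var 2))))
        (pair (pair (var 4) (var 2)) (var 3))
        (pair (var 0) (pair (var 2) (var 1))))
      nil)
    (pair nil nil)) nil) nil

/-- `(l, l') ↦ l ++ l'` -/
def appendBody : Term :=
  casePair (var 0)
    (casePair (var 0) (pair (var 0) (call 6 (pair (var 1) (var 3)))) (var 1))
    nil

/-- `(X, U) ↦ (C, U \ C)`, where `C` consists of `X` and the vertices of `U` that are reachable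
from `X`. -/
def growBody : Term :=
  casePair (var 0)
    (casePair (call 5 (pair nil (pair (var 0) (var 1))))
      (casePair (var 0)
        (call 7 (pair (call 6 (pair (var 2) (var 4))) (var 3)))
        (pair (var 2) (var 3)))
      nil)
    nil

/-- `(A, Q)` is mapped to a decomposition tree of `A`, whose topmost vertex cuts are taken at
vertices of `Q` if possible. -/
def buildBody : Term :=
  casePair (var 0) (casePair (var 0)
    (casePair (call 7 (pair (pair (var 0) nil) (var 1)))
      (casePair (var 1)
        (pair (var 2) (pair (call 8 (pair (var 2) (var 7))) (call 8 (pair (var 3) (var 7)))))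
        (casePair (var 3)
          (bind
            (casePair (call 5 (pair nil (pair (var 6) (var 7))))
              (casePair (var 0) (var 0) (var 6))
              nil)
            (casePair (call 5 (pair nil (pair (pair (var 0) nil) (var 7))))
              (pair (var 0) (pair (call 8 (pair (var 0) nil)) (call 8 (pair (var 1) (var 0)))))
              nil))
          nil))
      nil)
    nil) nil

/-- The better of two solutions, which are given with their revenues. -/
def betterBody : Term :=
  casePair (var 0) (casePair (var 0) (casePair (var 3)
    (ifLe (var 2) (var 0) (var 5) (var 4)) nil) nil) nil

/-- The best solution with at most one element. -/
def bestBody : Term :=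
  casePair (var 0)
    (casePair (var 0) (casePair (var 1) (casePair (var 1)
      (call 9 (pair (pair (var 1) (pair (var 6) nil)) (call 10 (var 7))))
      nil) nil) nil)
    (pair zero nil)

/-- `(T, S)` is mapped to a best solution in `S`, along the decomposition tree `T`. -/
def solveBody : Term :=
  casePair (var 0)
    (casePair (var 0)
      (casePair (var 1)
        (casePair (call 5 (pair (pair (pair nil nil) nil) (pair (var 2) (var 5))))
          (call 12 (pair (pair (var 2) (pair (var 3) (var 0)))
            (pair (var 1) (pair nil (var 0)))))
          nil)
        nil)
      (call 10 (var 1)))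
    nil

/-- `((T₁, T₂, N), R, L, cs)` is mapped to the best solution over all extensions by elements of
`cs` of a set with the undominated elements `R` and the lists of private neighbors `L`. -/
def branchBody : Term :=
  casePair (var 0) (casePair (var 1) (casePair (var 1)
    (casePair (var 1)
      -- The first candidate is skipped here. It is also taken, below, if it has an undominated
      -- neighbor and every list of private neighbors survives.
      (bind (call 12 (pair (var 6) (pair (var 4) (pair (var 2) (var 1)))))
        (casePair (call 5 (pair (pair nil nil) (pair (pair (var 1) nil) (var 5))))
          (casePair (var 0)
            (casePair (call 14 (pair (var 5) (var 7)))
              (casePair (call 5 (pair (pair nil nil) (pair (pair (var 7) nil) (var 8))))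
                (call 9 (pair (var 8)
                  (call 12 (pair (var 15) (pair (var 7) (pair (pair (var 6) (var 2)) (var 1)))))))
                nil)
              (var 4))
            (var 2))
          nil))
      -- No candidate is left: items of `N` in conflict with the remaining `R` are discarded, which
      -- makes the two recursive problems independent.
      (casePair (var 4) (casePair (var 1)
        (casePair (call 5 (pair (pair nil nil) (pair (var 6) (var 1))))
          (call 13 (pair (call 11 (pair (var 4) (var 1))) (call 11 (pair (var 2) (var 8)))))
          nil) nil) nil))
    nil) nil) nil

/-- The union of two solutions, which are given with their revenues. -/
def combineBody : Term :=
  casePair (var 0) (casePair (var 0) (casePair (var 3)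
    (pair (add (var 2) (var 0)) (call 6 (pair (var 3) (var 1)))) nil) nil) nil

/-- `(x, L)` is mapped to the lists in `L` without the elements in conflict with `x`, if none
of them becomes empty. -/
def pruneBody : Term :=
  casePair (var 0)
    (casePair (var 1)
      (casePair (call 5 (pair (pair nil nil) (pair (pair (var 2) nil) (var 0))))
        (casePair (var 1)
          (casePair (call 14 (pair (var 6) (var 5)))
            (pair (pair (var 5) (var 0)) nil)
            nil)
          nil)
        nil)
      (pair nil nil))
    nil

/-- The records of a vertex with its colors, from `(vertex, color, revenues, rows)`. -/
def colorsBody : Term :=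
  casePair (var 0) (casePair (var 1) (casePair (var 1)
    (casePair (var 0) (casePair (var 3)
      (pair (pair (var 8) (pair (var 6) (pair (var 0) (var 2))))
        (call 15 (pair (var 8) (pair (pair nil (var 6)) (pair (var 3) (var 1))))))
      nil) nil)
    nil) nil) nil

/-- All records of a vertex with a color, from `(vertex number, adjacency rows, revenues)`. -/
noncomputable def itemsBody {k : ℕ} (H : SimpleGraph (Fin k)) : Term :=
  casePair (var 0) (casePair (var 1) (casePair (var 0) (casePair (var 3)
    (call 6 (pair
      (call 15 (pair (pair (var 6) (var 2)) (pair nil (pair (var 0)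
        -- The pattern graph is not part of the input; its non-adjacency matrix is written into the
        -- program.
        (Term.list (List.ofFn fun a => Term.list (List.ofFn fun b =>
          Term.ofProp (¬ H.Adj a b))))))))
      (call 16 (pair (pair nil (var 6)) (pair (var 3) (var 1))))))
    nil) nil) nil) nil

/-- The records of all vertices, from `(vertex number, adjacency rows)`. -/
def vertsBody : Term :=
  casePair (var 0) (casePair (var 1)
    (pair (pair (pair (var 2) (var 0)) nil) (call 17 (pair (pair nil (var 2)) (var 1))))
    nil) nil

/-- `(A, X)` is mapped to the list of the colors of the vertices in `A` in the solution `X`. -/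
def outBody : Term :=
  casePair (var 0) (casePair (var 0)
    (casePair (call 5 (pair (pair (pair nil nil) nil) (pair (pair (var 0) nil) (var 3))))
      (pair
        -- A vertex without an item yields `nil`, the number `0`; otherwise `pair nil` adds one to
        -- the unary color.
        (casePair (var 0)
          (casePair (var 0) (casePair (var 1) (pair nil (var 0)) nil) nil)
          nil)
        (call 18 (pair (var 3) (var 5))))
      nil)
    nil) nil

/-- The main function. -/
def mainBody : Term :=
  casePair (var 0)
    (bind (call 17 (pair nil (var 0)))
      (casePair (call 11 (pair (call 8 (pair (var 0) nil))
          (call 16 (pair nil (pair (var 1) (var 2))))))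
        (call 18 (pair (var 2) (var 1)))
        nil))
    nil

/-- The program for the pattern graph `H`. -/
noncomputable def prog {k : ℕ} (H : SimpleGraph (Fin k)) : Program :=
  -- The positions in this list are the indices used by `call` in the bodies.
  [mainBody, nthBody, eqnBody, relBody, anyBody, partBody, appendBody, growBody, buildBody,
    betterBody, bestBody, solveBody, branchBody, combineBody, pruneBody, colorsBody, itemsBody H,
    vertsBody, outBody]

end Bodies

/-! ### Lists -/

/-- The list of the codes of the elements. -/
def encL {α : Type*} (f : α → Val) (l : List α) : Val := encodeList (l.map f)

@[simp] theorem encL_nil {α : Type*} (f : α → Val) : encL f [] = .nil := rfl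

@[simp] theorem encL_cons {α : Type*} (f : α → Val) (a : α) (l : List α) :
    encL f (a :: l) = .pair (f a) (encL f l) := rfl

theorem encodeList_cons (a : Val) (l : List Val) :
    encodeList (a :: l) = .pair a (encodeList l) := rfl

theorem encodeNat_succ (m : ℕ) : encodeNat (m + 1) = .pair .nil (encodeNat m) := rfl

/-! ### Correctness and cost of lookup, equality, concatenation and splitting. -/

section Basic

variable {k : ℕ} {H : SimpleGraph (Fin k)}

theorem nth_runs (l : List Val) (i : ℕ) (h : i < l.length) :
    Runs (prog H) [.pair (encodeList l) (encodeNat i)] nthBody l[i] (20 * (i + 1)) := by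
  induction i generalizing l with
  | zero =>
    obtain _ | ⟨a, l⟩ := l
    · simp at h
    · exact (Runs.casePair (.var rfl) (.casePair (.var rfl) (.caseNil (.var rfl)
        (.var rfl)))).mono (by omega)
  | succ i ih =>
    obtain _ | ⟨a, l⟩ := l
    · simp at h
    · rw [encodeList_cons, encodeNat_succ]
      exact (Runs.casePair (.var rfl) (.casePair (.var rfl) (.casePair (.var rfl)
        (.call (.pair (.var rfl) (.var rfl)) rfl (ih l (by simpa using h)))))).mono (by omega)

theorem nth_ofFn_runs {m : ℕ} (f : Fin m → Val) (i : Fin m) :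
    Runs (prog H) [.pair (encodeList (List.ofFn f)) (encodeNat i)] nthBody (f i) (20 * m) := by
  have := nth_runs (H := H) (List.ofFn f) i (by simp)
  simp only [List.getElem_ofFn] at this
  exact this.mono (by have := i.2; omega)

theorem true_runs {P : Program} {env : List Val} {p : Prop} (hp : p) :
    Runs P env Term.true (encodeProp p) 3 := by
  rw [encodeProp, if_pos hp]
  exact .pair .nil .nil

theorem nil_runs {P : Program} {env : List Val} {p : Prop} (hp : ¬ p) :
    Runs P env Term.nil (encodeProp p) 1 := by
  rw [encodeProp, if_neg hp]
  exact .nil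

theorem eqn_runs (i j : ℕ) :
    Runs (prog H) [.pair (encodeNat i) (encodeNat j)] eqnBody (encodeProp (i = j))
      (20 * (i + 1)) := by
  induction i generalizing j with
  | zero =>
    obtain _ | j := j
    · exact (Runs.casePair (.var rfl) (.caseNil (.var rfl) (.caseNil (.var rfl)
        (true_runs rfl)))).mono (by omega)
    · exact (Runs.casePair (.var rfl) (.caseNil (.var rfl) (.casePair (.var rfl)
        (nil_runs (by simp))))).mono (by omega)
  | succ i ih =>
    obtain _ | j := j
    · exact (Runs.casePair (.var rfl) (.casePair (.var rfl) (.caseNil (.var rfl)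
        (nil_runs (by simp))))).mono (by omega)
    · rw [encodeNat_succ, encodeNat_succ]
      have := ih j
      rw [show (i = j) = (i + 1 = j + 1) by simp] at this
      exact (Runs.casePair (.var rfl) (.casePair (.var rfl) (.casePair (.var rfl)
        (.call (.pair (.var rfl) (.var rfl)) rfl this)))).mono (by omega)

theorem append_runs {α : Type*} (f : α → Val) (l l' : List α) :
    Runs (prog H) [.pair (encL f l) (encL f l')] appendBody (encL f (l ++ l'))
      (20 * (l.length + 1)) := by
  induction l with
  | nil => exact (Runs.casePair (.var rfl) (.caseNil (.var rfl) (.var rfl))).mono (by omega)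
  | cons a l ih =>
    exact (Runs.casePair (.var rfl) (.casePair (.var rfl) (.pair (.var rfl)
      (.call (.pair (.var rfl) (.var rfl)) rfl ih)))).mono (by simp; omega)

/-! ### Splitting a list by a relation -/

variable {α β : Type*} {r : α → β → Prop} {c : Val} {f : α → Val} {g : β → Val} {τ : ℕ}

open Classical in
/-- The elements of `U` that are related to an element of `X`. -/
noncomputable def hits (r : α → β → Prop) (X : List α) (U : List β) : List β :=
  U.filter fun u => ∃ x ∈ X, r x u

open Classical in
/-- The elements of `U` that are not related to any element of `X`. -/
noncomputable def misses (r : α → β → Prop) (X : List α) (U : List β) : List β :=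
  U.filter fun u => ¬ ∃ x ∈ X, r x u

theorem mem_hits {X : List α} {U : List β} {u : β} :
    u ∈ hits r X U ↔ u ∈ U ∧ ∃ x ∈ X, r x u := by simp [hits]

theorem mem_misses {X : List α} {U : List β} {u : β} :
    u ∈ misses r X U ↔ u ∈ U ∧ ∀ x ∈ X, ¬ r x u := by simp [misses]

theorem hits_cons_of_pos {X : List α} {U : List β} {u : β} (h : ∃ x ∈ X, r x u) :
    hits r X (u :: U) = u :: hits r X U := List.filter_cons_of_pos (by simpa using h)

theorem hits_cons_of_neg {X : List α} {U : List β} {u : β} (h : ¬ ∃ x ∈ X, r x u) :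
    hits r X (u :: U) = hits r X U := List.filter_cons_of_neg (by simpa using h)

theorem misses_cons_of_pos {X : List α} {U : List β} {u : β} (h : ∃ x ∈ X, r x u) :
    misses r X (u :: U) = misses r X U := List.filter_cons_of_neg (by simpa using h)

theorem misses_cons_of_neg {X : List α} {U : List β} {u : β} (h : ¬ ∃ x ∈ X, r x u) :
    misses r X (u :: U) = u :: misses r X U := List.filter_cons_of_pos (by simpa using h)

theorem length_hits_le {X : List α} {U : List β} : (hits r X U).length ≤ U.length :=
  List.length_filter_le _ _

theorem length_misses_le {X : List α} {U : List β} : (misses r X U).length ≤ U.length :=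
  List.length_filter_le _ _

theorem nodup_hits {X : List α} {U : List β} (h : U.Nodup) : (hits r X U).Nodup := h.filter _

theorem nodup_misses {X : List α} {U : List β} (h : U.Nodup) : (misses r X U).Nodup := h.filter _

theorem hits_append_misses_perm (X : List α) (U : List β) :
    (hits r X U ++ misses r X U).Perm U := by
  classical
  have := List.filter_append_perm (fun u => decide (∃ x ∈ X, r x u)) U
  simpa only [hits, misses, decide_not] using this

theorem length_hits_add_length_misses (X : List α) (U : List β) :
    (hits r X U).length + (misses r X U).length = U.length := by
  rw [← List.length_append, (hits_append_misses_perm X U).length_eq]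

/-- The code `c` selects the relation `r`. -/
def RelRuns (H : SimpleGraph (Fin k)) (c : Val) (f : α → Val) (g : β → Val) (r : α → β → Prop)
    (τ : ℕ) : Prop :=
  ∀ x y, Runs (prog H) [.pair c (.pair (f x) (g y))] relBody (encodeProp (r x y)) τ

theorem any_runs (h : RelRuns H c f g r τ) (X : List α) (u : β) :
    Runs (prog H) [.pair c (.pair (encL f X) (g u))] anyBody (encodeProp (∃ x ∈ X, r x u))
      ((τ + 30) * (X.length + 1)) := by
  induction X with
  | nil =>
    exact (Runs.casePair (.var rfl) (.casePair (.var rfl) (.caseNil (.var rfl)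
      (nil_runs (by simp))))).mono (by simp)
  | cons x X ih =>
    refine (Runs.casePair (.var rfl) (.casePair (.var rfl) (.casePair (.var rfl)
      (.caseProp (.call (.pair (.var rfl) (.pair (.var rfl) (.var rfl))) rfl (h x u))
        (B' := (τ + 30) * (X.length + 1) + 10)
        (fun hx => (true_runs (by simp [hx])).mono (by omega)) fun hx => ?_)))).mono ?_
    · have : (∃ y ∈ x :: X, r y u) ↔ ∃ y ∈ X, r y u := by simp [hx]
      rw [this]
      exact (Runs.call (.pair (.var rfl) (.pair (.var rfl) (.var rfl))) rfl ih).mono (by omega)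
    · simp only [List.length_cons]
      linarith

theorem part_runs_aux (h : RelRuns H c f g r τ) (X : List α) (U : List β) :
    Runs (prog H) [.pair c (.pair (encL f X) (encL g U))] partBody
      (.pair (encL g (hits r X U)) (encL g (misses r X U)))
      (((τ + 30) * (X.length + 1) + 40) * (U.length + 1)) := by
  induction U with
  | nil =>
    exact (Runs.casePair (.var rfl) (.casePair (.var rfl) (.caseNil (.var rfl)
      (.pair .nil .nil)))).mono (by simp)
  | cons u U ih =>
    refine (Runs.casePair (.var rfl) (.casePair (.var rfl) (.casePair (.var rfl)
      (.casePair (.call (.pair (.var rfl) (.pair (.var rfl) (.var rfl))) rfl ih)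
        (.caseProp (.call (.pair (.var rfl) (.pair (.var rfl) (.var rfl))) rfl (any_runs h X u))
        (B' := 5) (fun hx => ?_) fun hx => ?_))))).mono ?_
    · rw [hits_cons_of_pos hx, misses_cons_of_pos hx]
      exact Runs.pair (.pair (.var rfl) (.var rfl)) (.var rfl)
    · rw [hits_cons_of_neg hx, misses_cons_of_neg hx]
      exact Runs.pair (.var rfl) (.pair (.var rfl) (.var rfl))
    · simp only [List.length_cons]
      linarith

/-- A single parameter bounds the cost of one test and both lengths, so all later splits share one
price; `100 ≤ M` absorbs the constants. -/
theorem part_runs {M : ℕ} (hM : 100 ≤ M) (h : RelRuns H c f g r M) {X : List α} {U : List β}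
    (hX : X.length ≤ M) (hU : U.length ≤ M) :
    Runs (prog H) [.pair c (.pair (encL f X) (encL g U))] partBody
      (.pair (encL g (hits r X U)) (encL g (misses r X U))) (M ^ 4) := by
  refine (part_runs_aux h X U).mono ?_
  calc ((M + 30) * (X.length + 1) + 40) * (U.length + 1)
      ≤ ((M + M) * (M + M) + M * M) * (M + M) := by gcongr <;> nlinarith
    _ = 10 * M ^ 3 := by ring
    _ ≤ M * M ^ 3 := by gcongr; omega
    _ = M ^ 4 := by ring

end Basic

/-! ### Records -/

section Records

variable {n k : ℕ} (G : SimpleGraph (Fin n)) (H : SimpleGraph (Fin k)) (rev : Fin n → Fin k → ℝ)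

/-- The row of a vertex in the adjacency matrix. -/
noncomputable def encRow (v : Fin n) : Val :=
  encodeList (List.ofFn fun u => encodeProp (G.Adj v u))

/-- The row of a color in the matrix of non-adjacent colors. -/
noncomputable def encColorRow (a : Fin k) : Val :=
  encodeList (List.ofFn fun b => encodeProp (¬ H.Adj a b))

/-- The record of a vertex. -/
noncomputable def encVert (v : Fin n) : Val := .pair (.pair (encodeNat v) (encRow G v)) .nil

/-- The record of a vertex with a color. -/
noncomputable def encItem (x : Fin n × Fin k) : Val :=
  .pair (.pair (encodeNat x.1) (encRow G x.1))
    (.pair (encodeNat x.2) (.pair (encColorRow H x.2) (.num (rev x.1 x.2))))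

/-- A bound for all list lengths and for the time to decide a relation. -/
def scale (n k : ℕ) : ℕ := 100 * (n + 1) * (k + 1)

theorem le_scale (n k : ℕ) : 100 * (n + k + 1) + n * k ≤ scale n k := by
  unfold scale
  nlinarith [Nat.zero_le (n * k)]

/-- The code of the relation "adjacent vertices". -/
def codeAdj : Val := .nil

/-- The code of the relation "in conflict". -/
def codeConf : Val := .pair .nil .nil

/-- The code of the relation "same vertex". -/
def codeSame : Val := .pair (.pair .nil .nil) .nil

theorem adj_relRuns : RelRuns H codeAdj (encVert G) (encVert G) G.Adj (scale n k) := by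
  intro u v
  exact (Runs.casePair (.var rfl) (.casePair (.var rfl) (.casePair (.var rfl) (.casePair (.var rfl)
    (.casePair (.var rfl) (.casePair (.var rfl) (.caseNil (.var rfl)
      (.call (.pair (.var rfl) (.var rfl)) rfl
        (nth_ofFn_runs (fun v => encodeProp (G.Adj u v)) v))))))))).mono
    (by have := le_scale n k; omega)

theorem same_relRuns {α β : Type*} {f : α → Val} {g : β → Val} {p : α → Fin n} {q : β → Fin n}
    {r r' : α → Val} {s s' : β → Val}
    (hf : ∀ x, f x = .pair (.pair (encodeNat (p x)) (r x)) (r' x))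
    (hg : ∀ y, g y = .pair (.pair (encodeNat (q y)) (s y)) (s' y)) :
    RelRuns H codeSame f g (fun x y => p x = q y) (scale n k) := by
  intro x y
  rw [hf, hg]
  change Runs _ _ _ (encodeProp (p x = q y)) _
  rw [show (p x = q y) = ((p x : ℕ) = q y) by rw [Fin.ext_iff]]
  exact (Runs.casePair (.var rfl) (.casePair (.var rfl) (.casePair (.var rfl) (.casePair (.var rfl)
    (.casePair (.var rfl) (.casePair (.var rfl) (.casePair (.var rfl) (.casePair (.var rfl)
      (.call (.pair (.var rfl) (.var rfl)) rfl (eqn_runs (p x) (q y))))))))))).mono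
    (by have := le_scale n k; have := (p x).2; omega)

theorem vert_item_relRuns : RelRuns H codeSame (encVert G) (encItem G H rev)
    (fun v x => v = x.1) (scale n k) :=
  same_relRuns H (fun _ => rfl) fun _ => rfl

theorem conf_relRuns : RelRuns H codeConf (encItem G H rev) (encItem G H rev) (Conf G H)
    (scale n k) := by
  intro x y
  refine (Runs.casePair (.var rfl) (.casePair (.var rfl) (.casePair (.var rfl) (.casePair (.var rfl)
    (.casePair (.var rfl) (.casePair (.var rfl) (.casePair (.var rfl) (.caseNil (.var rfl)
      (.caseProp (.call (.pair (.var rfl) (.var rfl)) rfl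
        (nth_ofFn_runs (fun v => encodeProp (G.Adj x.1 v)) y.1)) (B' := 20 * k + 30)
        (fun h => ?_) fun h => ?_))))))))).mono
    (by have := le_scale n k; omega)
  · rw [show Conf G H x y = ¬ H.Adj x.2 y.2 by simp [Conf, h]]
    exact (Runs.casePair (.var rfl) (.casePair (.var rfl) (.casePair (.var rfl)
      (.call (.pair (.var rfl) (.var rfl)) rfl
        (nth_ofFn_runs (fun b => encodeProp (¬ H.Adj x.2 b)) y.2))))).mono (by omega)
  · exact (nil_runs fun h' => h h'.1).mono (by omega)

end Records

/-! ### Construction of the decomposition tree -/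

section Build

variable {n k : ℕ} {G : SimpleGraph (Fin n)} {H : SimpleGraph (Fin k)}

/-- The code of a decomposition tree. -/
noncomputable def encDec (G : SimpleGraph (Fin n)) : Dec (Fin n) → Val
  | .leaf => .nil
  | .node B l r => .pair (encL (encVert G) B) (.pair (encDec G l) (encDec G r))

theorem length_le_scale {l : List (Fin n)} (h : l.Nodup) (k : ℕ) : l.length ≤ scale n k := by
  have h1 := h.length_le_card
  have h2 := le_scale n k
  simp only [Fintype.card_fin] at h1
  omega

theorem hundred_le_scale (n k : ℕ) : 100 ≤ scale n k := by
  have := le_scale n k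
  omega

/-- Each round moves to `X` all vertices of `U` that it sees, which keeps it linked, and the process
stops when it sees none. Every round but the last moves a vertex, so there are at most `U.length +
1` rounds. -/
theorem grow_runs (U : List (Fin n)) : ∀ X : List (Fin n), (X ++ U).Nodup →
    IsLinked G {x | x ∈ X} →
    ∃ C D, Runs (prog H) [.pair (encL (encVert G) X) (encL (encVert G) U)] growBody
        (.pair (encL (encVert G) C) (encL (encVert G) D)) (2 * scale n k ^ 4 * (U.length + 1)) ∧
      (C ++ D).Perm (X ++ U) ∧ X ⊆ C ∧ IsLinked G {x | x ∈ C} ∧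
      ∀ u ∈ C, ∀ v ∈ D, ¬ G.Adj u v := by
  induction hm : U.length using Nat.strong_induction_on generalizing U with
  | _ m ih =>
  subst hm
  intro X hnd hX
  have hM := hundred_le_scale n k
  have hXn := length_le_scale (List.nodup_append.1 hnd).1 k
  have hUn := length_le_scale (List.nodup_append.1 hnd).2.1 k
  have hpart := part_runs hM (adj_relRuns G H) hXn hUn
  have hM4 : scale n k * 100 ≤ scale n k ^ 4 := by
    calc scale n k * 100 ≤ scale n k * scale n k ^ 3 := by
          gcongr
          exact hM.trans (Nat.le_self_pow (by omega) _)
      _ = _ := by ring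
  have hlen := length_hits_add_length_misses (r := G.Adj) X U
  have hperm := hits_append_misses_perm (r := G.Adj) X U
  by_cases hY : hits G.Adj X U = []
  · rw [hY] at hpart
    refine ⟨X, U, (Runs.casePair (.var rfl) (.casePair (.call (.pair .nil (.pair (.var rfl)
      (.var rfl))) rfl hpart) (.caseNil (.var rfl) (.pair (.var rfl) (.var rfl))))).mono ?_,
      .refl _, List.Subset.refl _, hX, fun u hu v hv huv => ?_⟩
    · nlinarith
    · have : v ∈ hits G.Adj X U := mem_hits.2 ⟨hv, u, hu, huv⟩
      simp [hY] at this
  · obtain ⟨y, Y, hYeq⟩ := List.exists_cons_of_ne_nil hY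
    have hp : (hits G.Adj X U ++ X ++ misses G.Adj X U).Perm (X ++ U) := by
      refine .trans ?_ ((List.Perm.refl X).append hperm)
      rw [← List.append_assoc]
      exact List.perm_append_comm.append_right _
    have hYlen : 0 < (hits G.Adj X U).length := List.length_pos_iff.2 hY
    obtain ⟨C, D, hrun, hCD, hXC, hC, hno⟩ := ih (misses G.Adj X U).length (by omega) _ rfl
      (hits G.Adj X U ++ X) (hp.nodup_iff.2 hnd) (by
        have := hX.union (Y := {v | v ∈ hits G.Adj X U}) fun v hv => (mem_hits.1 hv).2
        convert this using 1
        ext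
        simp [or_comm])
    have happ : Runs (prog H) [.pair (encL (encVert G) (y :: Y)) (encL (encVert G) X)] appendBody
        (encL (encVert G) (hits G.Adj X U ++ X)) (20 * ((hits G.Adj X U).length + 1)) := by
      rw [← hYeq]
      exact append_runs _ _ _
    rw [hYeq] at hpart
    refine ⟨C, D, (Runs.casePair (.var rfl) (.casePair (.call (.pair .nil (.pair (.var rfl)
      (.var rfl))) rfl hpart) (.casePair (.var rfl) (.call (.pair (.call (.pair (.var rfl)
      (.var rfl)) rfl happ) (.var rfl)) rfl hrun)))).mono ?_, hCD.trans hp,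
      fun x hx => hXC (by simp [hx]), hC, hno⟩
    have h1 : (misses G.Adj X U).length + 1 ≤ U.length := by omega
    have h2 := Nat.mul_le_mul_left (2 * scale n k ^ 4) h1
    have h3 : (hits G.Adj X U).length ≤ scale n k := length_hits_le.trans hUn
    linarith

/-- The invariant of the construction: `p` is an induced path of vertices that have been used for
cuts, which have no neighbors in `A`, and it can be extended by each vertex in `Q`. -/
structure BuildInv (G : SimpleGraph (Fin n)) (s : ℕ) (p A Q : List (Fin n)) : Prop where
  -- Cliques are measured in `A` and `Q` together, because a pivot may lie in `Q` outside `A`.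
  clique : ∀ K : Finset (Fin n), (∀ v ∈ K, v ∈ A ∨ v ∈ Q) → G.IsClique (K : Set (Fin n)) →
    K.card ≤ s
  anti : ∀ z ∈ p, ∀ a ∈ A, ¬ G.Adj z a
  path : ∀ u ∈ Q, IsIndPath G (u :: p)
  nil : p = [] → Q = []
  -- Every union of components of `A` is seen from `Q`, so each component has a pivot that prolongs
  -- the path.
  reach : p ≠ [] → ∀ C : Set (Fin n), C ⊆ {a | a ∈ A} → C.Nonempty →
    (∀ u ∈ C, ∀ v ∈ A, v ∉ C → ¬ G.Adj u v) → ∃ q ∈ Q, ∃ c ∈ C, G.Adj q c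
  -- Four path vertices, one of `Q` and one of `A` would form an induced `P₆`.
  length : A ≠ [] → p.length ≤ 3

namespace BuildInv

variable {s : ℕ} {p A Q : List (Fin n)}

/-- What is closed within a closed part of `A` is closed in `A`, so `reach` passes to unions of
components. -/
theorem restrict (h : BuildInv G s p A Q) {C : List (Fin n)} (hC : C ⊆ A)
    (hcl : ∀ u ∈ C, ∀ v ∈ A, v ∉ C → ¬ G.Adj u v) : BuildInv G s p C Q where
  clique K hK := h.clique K fun v hv => (hK v hv).imp_left fun h => hC h
  anti z hz a ha := h.anti z hz a (hC ha)
  path := h.path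
  nil := h.nil
  reach hp B hB hne hBcl := h.reach hp B (hB.trans hC) hne fun u hu v hv hvB => by
    by_cases hvC : v ∈ C
    · exact hBcl u hu v hvC hvB
    · exact hcl u (hB hu) v hv hvC
  length hne := h.length (by rintro rfl; exact hne (List.eq_nil_of_subset_nil hC))

theorem one_le (h : BuildInv G s p A Q) {w : Fin n} (hw : w ∈ A ∨ w ∈ Q) : 1 ≤ s := by
  simpa using h.clique {w} (by simpa using hw) (by simp)

/-- A clique among the neighbors of `w` can be enlarged by `w`; this lowers `s` and the path starts
afresh. -/
theorem neighbors (h : BuildInv G s p A Q) {w : Fin n} (hw : w ∈ A ∨ w ∈ Q) :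
    BuildInv G (s - 1) [] (hits G.Adj [w] A) [] where
  clique K hK hcl := by
    have hK' : ∀ v ∈ K, v ∈ A ∧ G.Adj w v := fun v hv => by
      simpa [mem_hits] using hK v hv
    have hwK : w ∉ K := fun h => G.irrefl (hK' w h).2
    have := h.clique (insert w K) (by
      intro v hv
      rcases Finset.mem_insert.1 hv with rfl | hv
      · exact hw
      · exact Or.inl (hK' v hv).1) (by
      rw [Finset.coe_insert]
      exact hcl.insert fun b hb _ => (hK' b hb).2)
    rw [Finset.card_insert_of_notMem hwK] at this
    omega
  anti := by simp
  path := by simp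
  nil _ := rfl
  reach h := absurd rfl h
  length := by simp

/-- The step of the Gyárfás path. A closed part of the non-neighbors of `w` that sees no neighbor of
`w` in `A` would be closed in the linked set `A` and miss `a`; hence the neighbors of `w` serve as
the new `Q`. -/
theorem nonNeighbors (hP : ¬ (SimpleGraph.pathGraph 6).IsIndContained G)
    (h : BuildInv G s p A Q) (hA : IsLinked G {a | a ∈ A}) {x y : Fin n} (hx : x ∈ A) (hy : y ∈ A)
    (hxy : x ≠ y) {w : Fin n} (hw : IsIndPath G (w :: p)) {a : Fin n} (ha : a ∈ A)
    (hwa : G.Adj w a) :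
    BuildInv G s (w :: p) (misses G.Adj [w] A) (hits G.Adj [w] A) := by
  have hN : ∀ v, v ∈ hits G.Adj [w] A ↔ v ∈ A ∧ G.Adj w v := by simp [mem_hits]
  have hR : ∀ v, v ∈ misses G.Adj [w] A ↔ v ∈ A ∧ ¬ G.Adj w v := by simp [mem_misses]
  -- In a linked set with two elements every vertex has a neighbor, whereas the path vertices have
  -- none in `A`.
  have hAp : ∀ z ∈ p, z ∉ A := by
    intro z hz hzA
    obtain ⟨b, hb, hzb⟩ : ∃ b ∈ {a | a ∈ A}, G.Adj z b := by
      by_cases hzx : z = x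
      · exact hA.exists_adj hzA hy (by rw [hzx]; exact hxy.symm)
      · exact hA.exists_adj hzA hx (Ne.symm hzx)
    exact h.anti z hz b hb hzb
  have hpath : ∀ u ∈ hits G.Adj [w] A, IsIndPath G (u :: w :: p) := fun u hu =>
    ⟨((hN u).1 hu).2.symm, fun z hz => ⟨fun huz => h.anti z hz u ((hN u).1 hu).1 huz.symm,
      fun huz => hAp z hz (huz ▸ ((hN u).1 hu).1)⟩, hw⟩
  have hreach : ∀ C : Set (Fin n), C ⊆ {a | a ∈ misses G.Adj [w] A} → C.Nonempty →
      (∀ u ∈ C, ∀ v ∈ misses G.Adj [w] A, v ∉ C → ¬ G.Adj u v) →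
      ∃ q ∈ hits G.Adj [w] A, ∃ c ∈ C, G.Adj q c := by
    intro C hC hne hcl
    by_contra! hcon
    have := hA C (fun c hc => ((hR c).1 (hC hc)).1) hne fun u hu v hv hvC huv => by
      by_cases hwv : G.Adj w v
      · exact hcon v ((hN v).2 ⟨hv, hwv⟩) u hu huv.symm
      · exact hcl u hu v ((hR v).2 ⟨hv, hwv⟩) hvC huv
    have haC : a ∈ C := this ▸ ha
    exact ((hR a).1 (hC haC)).2 hwa
  refine ⟨fun K hK => h.clique K fun v hv => Or.inl ?_, ?_, hpath, nofun, fun _ => hreach, ?_⟩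
  · exact (hK v hv).elim (fun h => ((hR v).1 h).1) fun h => ((hN v).1 h).1
  · intro z hz b hb
    rcases List.mem_cons.1 hz with rfl | hz
    · exact ((hR b).1 hb).2
    · exact h.anti z hz b ((hR b).1 hb).1
  · intro hne
    by_contra! hlen
    have hlen' : p.length = 3 := by
      have := h.length (List.ne_nil_of_mem hx)
      simp only [List.length_cons] at hlen
      omega
    -- The vertices `c`, `q`, `w` and the three of `p` now form an induced path on six vertices.
    obtain ⟨q, hq, c, hc, hqc⟩ := hreach {v | v ∈ misses G.Adj [w] A} subset_rfl
      (List.exists_mem_of_ne_nil _ hne) fun _ _ v hv hv' => absurd hv hv'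
    have hcA := (hR c).1 hc
    obtain ⟨p₁, p₂, p₃, rfl⟩ := List.length_eq_three.1 hlen'
    have hwA : w ∉ A := fun hwA => h.anti p₁ (by simp) w hwA hw.1.symm
    refine hP (IsIndPath.pathGraph_six (a := c) (b := q) ⟨hqc.symm, fun z hz => ?_, hpath q hq⟩)
    rcases List.mem_cons.1 hz with rfl | hz
    · exact ⟨fun h => hcA.2 h.symm, fun h => hwA (h ▸ hcA.1)⟩
    · exact ⟨fun h' => h.anti z hz c hcA.1 h'.symm, fun h' => hAp z hz (h' ▸ hcA.1)⟩

end BuildInv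

/-- The number of pivots still possible on a branch is bounded by the potential `4 * s - p.length`.
The term `min Q.length 1` in the measure and in the size bound is needed because a pivot in `Q`
outside `A` may be adjacent to all of `A`: then the neighbor side is not smaller, but its `Q` is
empty. -/
theorem build_runs (hP : ¬ (SimpleGraph.pathGraph 6).IsIndContained G) (m : ℕ) :
    ∀ (s : ℕ) (p A Q : List (Fin n)), 2 * A.length + min Q.length 1 = m → A.Nodup → Q.Nodup →
      BuildInv G s p A Q →
      ∃ T : Dec (Fin n), Runs (prog H) [.pair (encL (encVert G) A) (encL (encVert G) Q)] buildBody
          (encDec G T) (scale n k ^ 7 * (2 * T.size + 1)) ∧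
        T.Ok G {v | v ∈ A} (4 * s - p.length) ∧ (A = [] → T.size = 0) ∧
        (A ≠ [] → T.size + 3 ≤ 3 * A.length + min Q.length 1) := by
  induction m using Nat.strong_induction_on with
  | _ m ih =>
  rintro s p A Q rfl hAnd hQnd hinv
  have hM := hundred_le_scale n k
  have hM4 : 100 ≤ scale n k ^ 4 := hM.trans (Nat.le_self_pow (by omega) _)
  obtain ⟨Z, hZ⟩ : ∃ Z, Z = scale n k ^ 4 * scale n k := ⟨_, rfl⟩
  have hM7 : 6 * Z ≤ scale n k ^ 7 := by
    calc 6 * Z ≤ scale n k ^ 2 * Z := by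
          gcongr
          exact (by omega : 6 ≤ scale n k).trans (Nat.le_self_pow (by omega) _)
      _ = _ := by rw [hZ]; ring
  have hM4' : scale n k ^ 4 * 100 ≤ Z := by
    rw [hZ]
    gcongr
  obtain _ | ⟨v, A'⟩ := A
  · refine ⟨.leaf, (Runs.casePair (.var rfl) (.caseNil (.var rfl) .nil)).mono ?_,
      .leaf (by simp), fun _ => rfl, fun h => absurd rfl h⟩
    rw [Dec.size]
    omega
  have hAn := length_le_scale hAnd k
  have hQn := length_le_scale hQnd k
  obtain ⟨C, D, hgrow, hperm, hvC, hC, hno⟩ := grow_runs (G := G) (H := H) A' [v] hAnd (by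
    intro B hB hne _
    obtain ⟨b, hb⟩ := hne
    have : b = v := by simpa using hB hb
    subst this
    refine hB.antisymm fun x hx => ?_
    obtain rfl : x = b := by simpa using hx
    exact hb)
  have hCDnd : (C ++ D).Nodup := hperm.nodup_iff.2 hAnd
  have hlenCD : C.length + D.length = A'.length + 1 := by
    simpa [add_comm] using hperm.length_eq
  have hmem : ∀ u, u ∈ v :: A' ↔ u ∈ C ∨ u ∈ D := fun u => by
    simpa using (hperm.mem_iff (a := u)).symm
  have hvC : v ∈ C := hvC (by simp)
  have hCpos : 0 < C.length := List.length_pos_of_mem hvC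
  have hdisj := (List.nodup_append.1 hCDnd).2.2
  have hgrow' : 2 * scale n k ^ 4 * (A'.length + 1) ≤ 2 * Z := by
    rw [hZ, mul_assoc]
    gcongr
    exact hAn
  by_cases hD : D = []
  · subst hD
    have hmem : ∀ u, u ∈ C ↔ u ∈ v :: A' := fun u => by simp [hmem]
    obtain _ | ⟨u, A''⟩ := A'
    · refine ⟨.leaf, (Runs.casePair (.var rfl) (.casePair (.var rfl) (.casePair (.call (.pair (.pair
        (.var rfl) .nil) (.var rfl)) rfl hgrow) (.caseNil (.var rfl) (.caseNil (.var rfl)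
        .nil))))).mono ?_, .leaf (by simp), fun _ => rfl, fun _ => ?_⟩
      · simp only [Dec.size]
        linarith
      · simp [Dec.size]
    generalize hA' : u :: A'' = A' at *
    have hu : u ∈ v :: A' := by simp [← hA']
    have hv : v ∈ v :: A' := by simp
    have huv : v ≠ u := fun h => (List.nodup_cons.1 hAnd).1 (by simp [← hA', h])
    have hA : IsLinked G {a | a ∈ v :: A'} := by
      convert hC using 1
      ext a
      exact (hmem a).symm
    have hpart := part_runs hM (adj_relRuns G H) hAn hQn
    obtain ⟨w, hwAQ, hwp, ⟨a, ha, hwa⟩, hwrun⟩ : ∃ w, (w ∈ v :: A' ∨ w ∈ Q) ∧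
        IsIndPath G (w :: p) ∧ (∃ a ∈ v :: A', G.Adj w a) ∧
        ∀ (a b c d env : _), Runs (prog H) (a :: b :: c :: d :: encVert G v :: encL (encVert G) A' ::
          encL (encVert G) (v :: A') :: encL (encVert G) Q :: env)
          (.casePair (.call 5 (.pair .nil (.pair (.var 6) (.var 7))))
              (.casePair (.var 0) (.var 0) (.var 6))
              .nil) (encVert G w) (scale n k ^ 4 + 20) := by
      by_cases hY : hits G.Adj (v :: A') Q = []
      -- By `reach`, a nonempty path always has a continuation in `Q`; only a new path may start at
      -- an arbitrary vertex `v`.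
      · have hp : p = [] := by
          by_contra hp
          obtain ⟨q, hq, c, hc, hqc⟩ := hinv.reach hp {a | a ∈ v :: A'} subset_rfl ⟨v, hv⟩
            fun _ _ x hx hx' => absurd hx hx'
          have : q ∈ hits G.Adj (v :: A') Q := mem_hits.2 ⟨hq, c, hc, hqc.symm⟩
          simp [hY] at this
        subst hp
        rw [hY] at hpart
        refine ⟨v, Or.inl hv, trivial, hA.exists_adj hv hu huv.symm, fun _ _ _ _ _ => ?_⟩
        exact (Runs.casePair (.call (.pair .nil (.pair (.var rfl) (.var rfl))) rfl hpart)
          (.caseNil (.var rfl) (.var rfl))).mono (by omega)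
      · obtain ⟨w, Y, hYeq⟩ := List.exists_cons_of_ne_nil hY
        have hw : w ∈ hits G.Adj (v :: A') Q := by simp [hYeq]
        obtain ⟨hwQ, a, ha, haw⟩ := mem_hits.1 hw
        rw [hYeq] at hpart
        refine ⟨w, Or.inr hwQ, hinv.path w hwQ, ⟨a, ha, haw.symm⟩, fun _ _ _ _ _ => ?_⟩
        exact (Runs.casePair (.call (.pair .nil (.pair (.var rfl) (.var rfl))) rfl hpart)
          (.casePair (.var rfl) (.var rfl))).mono (by omega)
    have hlen := length_hits_add_length_misses (r := G.Adj) [w] (v :: A')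
    have hNpos : 0 < (hits G.Adj [w] (v :: A')).length :=
      List.length_pos_of_mem (mem_hits.2 ⟨ha, w, by simp, hwa⟩)
    have hQ0 : w ∈ v :: A' ∨ 0 < Q.length := hwAQ.imp_right List.length_pos_of_mem
    have hRpos : w ∈ v :: A' → 0 < (misses G.Adj [w] (v :: A')).length := fun hw =>
      List.length_pos_of_mem (mem_misses.2 ⟨hw, by simp⟩)
    have hs := hinv.one_le hwAQ
    have hp3 := hinv.length (by simp)
    obtain ⟨T₁, hT₁, hok₁, -, hsz₁⟩ := ih _ (by
      simp only [List.length_nil]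
      by_cases hw : w ∈ v :: A'
      · have := hRpos hw
        omega
      · have := hQ0.resolve_left hw
        omega) (s - 1) [] (hits G.Adj [w] (v :: A')) [] rfl
      (nodup_hits hAnd) .nil (hinv.neighbors hwAQ)
    obtain ⟨T₂, hT₂, hok₂, hsz₂', hsz₂⟩ := ih _ (by omega) s (w :: p)
      (misses G.Adj [w] (v :: A')) (hits G.Adj [w] (v :: A')) rfl
      (nodup_misses hAnd) (nodup_hits hAnd) (hinv.nonNeighbors hP hA hv hu huv hwp ha hwa)
    have hpart' := part_runs hM (adj_relRuns G H) (X := [w]) (U := v :: A')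
      (by simp only [List.length_singleton]; omega) hAn
    refine ⟨.node (hits G.Adj [w] (v :: A')) T₁ T₂, ?_, ?_, by simp, fun _ => ?_⟩
    · subst hA'
      refine (Runs.casePair (.var rfl) (.casePair (.var rfl) (.casePair (.call (.pair (.pair
        (.var rfl) .nil) (.var rfl)) rfl hgrow) (.caseNil (.var rfl) (.casePair (.var rfl)
        (.bind (hwrun _ _ _ _ _) (.casePair (.call (.pair .nil (.pair (.pair (.var rfl) .nil)
          (.var rfl))) rfl hpart') (.pair (.var rfl) (.pair (.call (.pair (.var rfl) .nil) rfl hT₁)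
            (.call (.pair (.var rfl) (.var rfl)) rfl hT₂)))))))))).mono ?_
      simp only [Dec.size]
      have : scale n k ^ 7 * (2 * (T₁.size + T₂.size + 1) + 1) = scale n k ^ 7 *
        (2 * T₁.size + 1) + scale n k ^ 7 * (2 * T₂.size + 1) + scale n k ^ 7 := by ring
      rw [this]
      linarith
    -- The potential is positive since `s ≥ 1` and `p.length ≤ 3`. It drops on both sides: to `4 *
    -- (s - 1)` with an empty path for the neighbors, and by one through the longer path for the
    -- others.
    · obtain ⟨d, hd⟩ : ∃ d, 4 * s - p.length = d + 1 := ⟨4 * s - p.length - 1, by omega⟩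
      rw [hd]
      refine .pivot w (nodup_hits hAnd) (fun x hx => ?_) (hok₁.anti (fun x hx => hx.2) ?_)
        (hok₂.anti (fun x hx => ?_) ?_)
      · have hx : x ∈ v :: A' := hx
        simp only [mem_hits, List.mem_singleton, exists_eq_left, hx, true_and]
      · simp only [List.length_nil]
        omega
      · have h1 : x ∈ v :: A' := hx.1
        have h2 := hx.2
        simp only [mem_hits, List.mem_singleton, exists_eq_left, h1, true_and] at h2
        exact mem_misses.2 ⟨h1, by simpa using h2⟩
      · simp only [List.length_cons]
        omega
    · have h1 := hsz₁ (List.length_pos_iff.1 hNpos)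
      simp only [Dec.size, List.length_nil] at *
      by_cases hR : misses G.Adj [w] (v :: A') = []
      · have h2 := hsz₂' hR
        have : w ∉ v :: A' := fun hw => by
          have := hRpos hw
          simp [hR] at this
        have := hQ0.resolve_left this
        simp only [hR, List.length_nil] at hlen
        omega
      · have h2 := hsz₂ hR
        omega
  · have hDpos := List.length_pos_iff.2 hD
    obtain ⟨x, D', hDeq⟩ := List.exists_cons_of_ne_nil hD
    have hCnd := (List.nodup_append.1 hCDnd).1
    have hDnd := (List.nodup_append.1 hCDnd).2.1
    obtain ⟨T₁, hT₁, hok₁, -, hsz₁⟩ := ih _ (by simp only [List.length_cons]; omega) s p C Q rfl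
      hCnd hQnd (hinv.restrict (fun u hu => (hmem u).2 (Or.inl hu)) fun u hu w hw hwC =>
        hno u hu w (((hmem w).1 hw).resolve_left hwC))
    obtain ⟨T₂, hT₂, hok₂, -, hsz₂⟩ := ih _ (by simp only [List.length_cons]; omega) s p D Q rfl
      hDnd hQnd (hinv.restrict (fun u hu => (hmem u).2 (Or.inr hu)) fun u hu w hw hwD huw =>
        hno w (((hmem w).1 hw).resolve_right hwD) u hu huw.symm)
    refine ⟨.node C T₁ T₂, ?_, ?_, by simp, fun _ => ?_⟩
    · subst hDeq
      refine (Runs.casePair (.var rfl) (.casePair (.var rfl) (.casePair (.call (.pair (.pair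
        (.var rfl) .nil) (.var rfl)) rfl hgrow) (.casePair (.var rfl) (.pair (.var rfl)
        (.pair (.call (.pair (.var rfl) (.var rfl)) rfl hT₁)
          (.call (.pair (.var rfl) (.var rfl)) rfl hT₂))))))).mono ?_
      simp only [Dec.size]
      have : scale n k ^ 7 * (2 * (T₁.size + T₂.size + 1) + 1) = scale n k ^ 7 *
        (2 * T₁.size + 1) + scale n k ^ 7 * (2 * T₂.size + 1) + scale n k ^ 7 := by ring
      rw [this]
      linarith
    · refine .split hCnd (fun u _ huC w hw hwC => hno u huC w (((hmem w).1 hw).resolve_left hwC))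
        (hok₁.anti (fun x hx => hx.2) le_rfl)
        (hok₂.anti (fun x hx => ((hmem x).1 hx.1).resolve_left hx.2) le_rfl)
    · have h1 := hsz₁ (List.length_pos_iff.1 hCpos)
      have h2 := hsz₂ hD
      simp only [Dec.size, List.length_cons] at *
      omega

end Build

/-! ### Solving along a decomposition tree -/

section Solve

variable {n k : ℕ} {G : SimpleGraph (Fin n)} {H : SimpleGraph (Fin k)}
  {rev : Fin n → Fin k → ℝ}

/-- The code of a solution together with its revenue. -/
noncomputable def encSol (G : SimpleGraph (Fin n)) (H : SimpleGraph (Fin k))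
    (rev : Fin n → Fin k → ℝ) (W : ℝ) (X : List (Fin n × Fin k)) : Val :=
  .pair (.num W) (encL (encItem G H rev) X)

/-- `X` is a partial coloring within `S`, of revenue `W`. -/
structure IsSol (G : SimpleGraph (Fin n)) (H : SimpleGraph (Fin k)) (rev : Fin n → Fin k → ℝ)
    (S : Set (Fin n × Fin k)) (W : ℝ) (X : List (Fin n × Fin k)) : Prop where
  subset : ∀ x ∈ X, x ∈ S
  nodup : X.Nodup
  valid : IsValid G H {x | x ∈ X}
  sum : W = (X.map fun x => rev x.1 x.2).sum

/-- `X` is a partial coloring within `S`, of maximum revenue `W`. -/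
structure IsBest (G : SimpleGraph (Fin n)) (H : SimpleGraph (Fin k)) (rev : Fin n → Fin k → ℝ)
    (S : Set (Fin n × Fin k)) (W : ℝ) (X : List (Fin n × Fin k)) : Prop
    extends IsSol G H rev S W X where
  le : ∀ Y : Finset (Fin n × Fin k), (∀ y ∈ Y, y ∈ S) → IsValid G H (Y : Set (Fin n × Fin k)) →
    ∑ y ∈ Y, rev y.1 y.2 ≤ W

theorem length_items_le_scale {l : List (Fin n × Fin k)} (h : l.Nodup) :
    l.length ≤ scale n k := by
  have h1 := h.length_le_card
  have h2 := le_scale n k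
  simp only [Fintype.card_prod, Fintype.card_fin] at h1
  omega

/-! ### Comparing, choosing and uniting solutions. -/

theorem better_runs (W₁ W₂ : ℝ) (X₁ X₂ : List (Fin n × Fin k)) :
    ∃ W X, Runs (prog H) [.pair (encSol G H rev W₁ X₁) (encSol G H rev W₂ X₂)] betterBody
        (encSol G H rev W X) 20 ∧
      (W = W₁ ∧ X = X₁ ∨ W = W₂ ∧ X = X₂) ∧ W₁ ≤ W ∧ W₂ ≤ W := by
  rcases le_or_gt W₁ W₂ with h | h
  · exact ⟨W₂, X₂, (Runs.casePair (.var rfl) (.casePair (.var rfl) (.casePair (.var rfl)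
      (.ifLe (.var rfl) (.var rfl) (fun _ => .var rfl)
      fun h' => absurd h (not_le.2 h'))))).mono (by omega), Or.inr ⟨rfl, rfl⟩, h, le_rfl⟩
  · exact ⟨W₁, X₁, (Runs.casePair (.var rfl) (.casePair (.var rfl) (.casePair (.var rfl)
      (.ifLe (.var rfl) (.var rfl) (fun h' => absurd h (not_lt.2 h'))
      fun _ => .var rfl)))).mono (by omega), Or.inl ⟨rfl, rfl⟩, le_rfl, h.le⟩

theorem best_runs (S : List (Fin n × Fin k)) :
    ∃ W X, Runs (prog H) [encL (encItem G H rev) S] bestBody (encSol G H rev W X)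
        (60 * (S.length + 1)) ∧
      (X = [] ∨ ∃ x ∈ S, X = [x]) ∧ W = (X.map fun x => rev x.1 x.2).sum ∧ 0 ≤ W ∧
      ∀ x ∈ S, rev x.1 x.2 ≤ W := by
  induction S with
  | nil =>
    exact ⟨0, [], (Runs.caseNil (.var rfl) (.pair .zero .nil)).mono (by simp), by simp⟩
  | cons x S ih =>
    obtain ⟨W, X, hrun, hX, hW, h0, hle⟩ := ih
    obtain ⟨W', X', hrun', h', h₁, h₂⟩ := better_runs (G := G) (H := H) (rev := rev)
      (rev x.1 x.2) W [x] X
    refine ⟨W', X', (Runs.casePair (.var rfl) (.casePair (.var rfl) (.casePair (.var rfl)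
      (.casePair (.var rfl) (.call (.pair (.pair (.var rfl) (.pair (.var rfl) .nil))
      (.call (.var rfl) rfl hrun)) rfl hrun'))))).mono ?_, ?_, ?_, h0.trans h₂, ?_⟩
    · simp only [List.length_cons]
      omega
    · rcases h' with ⟨-, rfl⟩ | ⟨-, rfl⟩
      · exact Or.inr ⟨x, by simp, rfl⟩
      · exact hX.imp_right fun ⟨y, hy, h⟩ => ⟨y, by simp [hy], h⟩
    · rcases h' with ⟨rfl, rfl⟩ | ⟨rfl, rfl⟩
      · simp
      · exact hW
    · intro y hy
      rcases List.mem_cons.1 hy with rfl | hy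
      · exact h₁
      · exact (hle y hy).trans h₂

theorem best_runs_isBest {A : Set (Fin n)} (hA : A.Subsingleton) {S : List (Fin n × Fin k)}
    (hS : ∀ x ∈ S, x.1 ∈ A) :
    ∃ W X, Runs (prog H) [encL (encItem G H rev) S] bestBody (encSol G H rev W X)
        (60 * (S.length + 1)) ∧ IsBest G H rev {x | x ∈ S} W X := by
  obtain ⟨W, X, hrun, hX, hW, h0, hle⟩ := best_runs (G := G) (H := H) (rev := rev) S
  have hX1 : ∀ x ∈ X, ∀ y ∈ X, x = y := by
    rcases hX with rfl | ⟨x, -, rfl⟩ <;> simp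
  refine ⟨W, X, hrun, ⟨?_, ?_, ⟨fun x hx y hy => ?_, fun x hx y hy _ => hX1 x hx y hy⟩, hW⟩,
    fun Y hYS hY => ?_⟩
  · rcases hX with rfl | ⟨x, hx, rfl⟩
    · simp
    · simpa using hx
  · rcases hX with rfl | ⟨x, -, rfl⟩ <;> simp
  · rw [hX1 x hx y hy]
    exact not_conf_self y
  · have hYc : Y.card ≤ 1 := Finset.card_le_one.2 fun x hx y hy =>
      hY.2 x hx y hy (hA (hS x (hYS x hx)) (hS y (hYS y hy)))
    rcases Y.eq_empty_or_nonempty with rfl | hne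
    · simpa using h0
    · obtain ⟨y, rfl⟩ := Finset.card_eq_one.1 (hYc.antisymm hne.card_pos)
      simpa using hle y (hYS y (by simp))

theorem combine_runs (W₁ W₂ : ℝ) (X₁ X₂ : List (Fin n × Fin k)) :
    Runs (prog H) [.pair (encSol G H rev W₁ X₁) (encSol G H rev W₂ X₂)] combineBody
        (encSol G H rev (W₁ + W₂) (X₁ ++ X₂)) (20 * X₁.length + 50) :=
  (Runs.casePair (.var rfl) (.casePair (.var rfl) (.casePair (.var rfl)
    (.pair (.add (.var rfl) (.var rfl)) (.call (.pair (.var rfl) (.var rfl)) rfl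
      (append_runs _ _ _)))))).mono (by omega)

theorem pow_four_le (n k : ℕ) : 100 * scale n k ≤ scale n k ^ 4 := by
  have hM := hundred_le_scale n k
  calc 100 * scale n k ≤ scale n k ^ 3 * scale n k := by
        gcongr
        exact hM.trans (Nat.le_self_pow (by omega) _)
    _ = _ := by ring

/-- The resulting list is wrapped in a pair, so that an empty `L` is not mistaken for failure. -/
theorem prune_runs (x : Fin n × Fin k) (L : List (List (Fin n × Fin k)))
    (hL : ∀ p ∈ L, p.length ≤ scale n k) :
    ((∀ p ∈ L, misses (Conf G H) [x] p ≠ []) →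
      Runs (prog H) [.pair (encItem G H rev x) (encL (encL (encItem G H rev)) L)] pruneBody
        (.pair (encL (encL (encItem G H rev)) (L.map (misses (Conf G H) [x]))) .nil)
        (2 * scale n k ^ 4 * (L.length + 1))) ∧
    ((¬ ∀ p ∈ L, misses (Conf G H) [x] p ≠ []) →
      Runs (prog H) [.pair (encItem G H rev x) (encL (encL (encItem G H rev)) L)] pruneBody
        .nil (2 * scale n k ^ 4 * (L.length + 1))) := by
  have hM := hundred_le_scale n k
  have hM4 := pow_four_le n k
  induction L with
  | nil =>
    refine ⟨fun _ => (Runs.casePair (.var rfl) (.caseNil (.var rfl) (.pair .nil .nil))).mono ?_,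
      by simp⟩
    simp only [List.length_nil]
    omega
  | cons p L ih =>
    obtain ⟨ih₁, ih₂⟩ := ih fun q hq => hL q (by simp [hq])
    have hpart := part_runs hM (conf_relRuns G H rev) (X := [x]) (U := p)
      (by simp only [List.length_singleton]; omega) (hL p (by simp))
    simp only [List.forall_mem_cons, List.map_cons, List.length_cons]
    by_cases hp : misses (Conf G H) [x] p = []
    · rw [hp] at hpart
      refine ⟨fun h => absurd hp h.1, fun _ => (Runs.casePair (.var rfl) (.casePair (.var rfl)
        (.casePair (.call (.pair (.pair .nil .nil) (.pair (.pair (.var rfl) .nil) (.var rfl)))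
        rfl hpart) (.caseNil (.var rfl) .nil)))).mono ?_⟩
      nlinarith
    obtain ⟨y, q, hq⟩ := List.exists_cons_of_ne_nil hp
    rw [hq] at hpart ⊢
    refine ⟨fun h => (Runs.casePair (.var rfl) (.casePair (.var rfl)
        (.casePair (.call (.pair (.pair .nil .nil) (.pair (.pair (.var rfl) .nil) (.var rfl)))
        rfl hpart) (.casePair (.var rfl) (.casePair (.call (.pair (.var rfl) (.var rfl)) rfl
          (ih₁ h.2)) (.pair (.pair (.var rfl) (.var rfl)) .nil)))))).mono ?_,
      fun h => (Runs.casePair (.var rfl) (.casePair (.var rfl)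
        (.casePair (.call (.pair (.pair .nil .nil) (.pair (.pair (.var rfl) .nil) (.var rfl)))
        rfl hpart) (.casePair (.var rfl) (.caseNil (.call (.pair (.var rfl) (.var rfl)) rfl
          (ih₂ fun h' => h ⟨by simp, h'⟩)) .nil))))).mono ?_⟩ <;> linarith

/-! ### Enumeration of irredundant sets. -/

open Classical in
/-- The private neighbors in `R` of the element `x` of `I`. -/
noncomputable def privates (G : SimpleGraph (Fin n)) (H : SimpleGraph (Fin k))
    (R I : List (Fin n × Fin k)) (x : Fin n × Fin k) : List (Fin n × Fin k) :=
  R.filter fun r => Conf G H x r ∧ ∀ y ∈ I, y ≠ x → ¬ Conf G H y r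

theorem mem_privates {R I : List (Fin n × Fin k)} {x r : Fin n × Fin k} :
    r ∈ privates G H R I x ↔ r ∈ R ∧ Conf G H x r ∧ ∀ y ∈ I, y ≠ x → ¬ Conf G H y r := by
  simp [privates]

theorem misses_cons {R I : List (Fin n × Fin k)} {x : Fin n × Fin k} :
    misses (Conf G H) [x] (misses (Conf G H) I R) = misses (Conf G H) (x :: I) R := by
  rw [misses, misses, misses, List.filter_filter]
  refine List.filter_congr fun r _ => ?_
  rw [Bool.eq_iff_iff]
  simp

/-- With `privates_cons_of_mem`, this lets the lists of private neighbors be maintained by splits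
alone when `x` joins `I`. -/
theorem privates_cons_self {R I : List (Fin n × Fin k)} {x : Fin n × Fin k} (hx : x ∉ I) :
    privates G H R (x :: I) x = hits (Conf G H) [x] (misses (Conf G H) I R) := by
  rw [misses, hits, privates, List.filter_filter]
  refine List.filter_congr fun r _ => ?_
  rw [Bool.eq_iff_iff]
  simp only [Bool.and_eq_true, decide_eq_true_eq]
  simp only [List.mem_cons, forall_eq_or_imp, ne_eq, not_true_eq_false, IsEmpty.forall_iff,
    true_and, List.not_mem_nil, or_false, exists_eq_left, not_exists, not_and]
  exact and_congr_right fun _ => forall₂_congr fun y hy =>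
    ⟨fun h => h fun h' => hx (h' ▸ hy), fun h _ => h⟩

theorem privates_cons_of_mem {R I : List (Fin n × Fin k)} {x y : Fin n × Fin k} (hx : x ∉ I)
    (hy : y ∈ I) :
    privates G H R (x :: I) y = misses (Conf G H) [x] (privates G H R I y) := by
  rw [misses, privates, privates, List.filter_filter]
  refine List.filter_congr fun r _ => ?_
  rw [Bool.eq_iff_iff]
  simp only [Bool.and_eq_true, decide_eq_true_eq]
  have hne : x ≠ y := fun h => hx (h ▸ hy)
  simp only [List.mem_cons, forall_eq_or_imp, List.not_mem_nil, or_false, exists_eq_left]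
  tauto

/-- The bound for the enumeration over `m` candidates of which at most `q` can be chosen. -/
def branchTime (K E m q : ℕ) : ℕ := (m + 1) ^ q * (K * (m + 1) + E)

theorem branchTime_mono {K E m m' q : ℕ} (h : m ≤ m') :
    branchTime K E m q ≤ branchTime K E m' q := by
  unfold branchTime
  gcongr

theorem branchTime_succ_left (K E m q : ℕ) :
    K + branchTime K E m q ≤ branchTime K E (m + 1) q := by
  unfold branchTime
  have h1 : (m + 1) ^ q ≤ (m + 1 + 1) ^ q := Nat.pow_le_pow_left (by omega) q
  have h2 : 1 ≤ (m + 1) ^ q := Nat.one_le_pow _ _ (by omega)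
  nlinarith [Nat.mul_le_mul_right (K * (m + 1) + E) h1, Nat.mul_le_mul_right K (h2.trans h1)]

/-- The recurrence of the enumeration: skipping a candidate keeps the budget `q + 1`, taking it
lowers the budget to `q`. -/
theorem branchTime_succ (K E m q : ℕ) :
    K + branchTime K E m (q + 1) + branchTime K E m q ≤ branchTime K E (m + 1) (q + 1) := by
  unfold branchTime
  have h1 : (m + 1) ^ (q + 1) + (m + 1) ^ q ≤ (m + 1 + 1) ^ (q + 1) := by
    have h1 : (m + 1) ^ q ≤ (m + 1 + 1) ^ q := Nat.pow_le_pow_left (by omega) q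
    rw [pow_succ, pow_succ]
    nlinarith
  have h2 : 1 ≤ (m + 1 + 1) ^ (q + 1) := Nat.one_le_pow _ _ (by omega)
  nlinarith [Nat.mul_le_mul_right (K * (m + 1) + E) h1, Nat.mul_le_mul_right K h2]

/-- `I₀` is the set chosen so far and `cs` the candidates left. Only irredundant `I₀` are visited,
so at most `q - I₀.length` further choices occur. The output is always a solution; its optimality is
claimed only against pairs `Y₁`, `Y₂` compatible with some irredundant `I` between `I₀` and `I₀ ∪
cs`, which is what the optimum supplies. -/
theorem branch_runs {T₁ T₂ : Dec (Fin n)} {N R : List (Fin n × Fin k)} (hN : N.Nodup)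
    (hR : R.Nodup) (hNR : ∀ x ∈ N, ∀ y ∈ R, x.1 ≠ y.1) {E₁ E₂ q : ℕ}
    (hq : ∀ I : List (Fin n × Fin k), I.Nodup →
      IsIrredundant G H {x | x ∈ N} {x | x ∈ R} {x | x ∈ I} → I.length ≤ q)
    (h₁ : ∀ S : List (Fin n × Fin k), S ⊆ N → S.Nodup → ∃ W X,
      Runs (prog H) [.pair (encDec G T₁) (encL (encItem G H rev) S)] solveBody
        (encSol G H rev W X) E₁ ∧ IsBest G H rev {x | x ∈ S} W X)
    (h₂ : ∀ S : List (Fin n × Fin k), S ⊆ R → S.Nodup → ∃ W X,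
      Runs (prog H) [.pair (encDec G T₂) (encL (encItem G H rev) S)] solveBody
        (encSol G H rev W X) E₂ ∧ IsBest G H rev {x | x ∈ S} W X) (m : ℕ) :
    ∀ cs I₀ : List (Fin n × Fin k), cs.length = m → cs ⊆ N → (cs ++ I₀).Nodup →
      IsIrredundant G H {x | x ∈ N} {x | x ∈ R} {x | x ∈ I₀} →
      (∀ x ∈ I₀, ∀ y ∈ cs, ¬ Conf G H x y) →
      ∃ W X, Runs (prog H) [.pair (.pair (encDec G T₁) (.pair (encDec G T₂)
          (encL (encItem G H rev) N))) (.pair (encL (encItem G H rev) (misses (Conf G H) I₀ R))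
          (.pair (encL (encL (encItem G H rev)) (I₀.map (privates G H R I₀)))
          (encL (encItem G H rev) cs)))] branchBody (encSol G H rev W X)
          (branchTime (scale n k ^ 6) (E₁ + E₂) m (q - I₀.length)) ∧
        IsSol G H rev {x | x ∈ N ∨ x ∈ R} W X ∧
        ∀ I : Finset (Fin n × Fin k), (∀ x ∈ I₀, x ∈ I) → (∀ x ∈ I, x ∈ I₀ ∨ x ∈ cs) →
          IsIrredundant G H {x | x ∈ N} {x | x ∈ R} (I : Set (Fin n × Fin k)) →
          ∀ Y₁ Y₂ : Finset (Fin n × Fin k),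
            (∀ x ∈ Y₁, x ∈ N ∧ ∀ r ∈ R, (∀ y ∈ I, ¬ Conf G H y r) → ¬ Conf G H r x) →
            (∀ r ∈ Y₂, r ∈ R ∧ ∀ y ∈ I, ¬ Conf G H y r) →
            IsValid G H (Y₁ : Set (Fin n × Fin k)) → IsValid G H (Y₂ : Set (Fin n × Fin k)) →
            ∑ x ∈ Y₁, rev x.1 x.2 + ∑ x ∈ Y₂, rev x.1 x.2 ≤ W := by
  have hM := hundred_le_scale n k
  have hM4 := pow_four_le n k
  have hM6 : 100 * (scale n k ^ 4 * scale n k) ≤ scale n k ^ 6 := by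
    calc 100 * (scale n k ^ 4 * scale n k) ≤ scale n k * (scale n k ^ 4 * scale n k) := by gcongr
      _ = _ := by ring
  have hM5 : 100 * scale n k ^ 4 ≤ scale n k ^ 4 * scale n k := by
    rw [mul_comm]
    gcongr
  have hNl := length_items_le_scale hN
  have hRl := length_items_le_scale hR
  induction m using Nat.strong_induction_on with
  | _ m ih =>
  rintro cs I₀ rfl hcsN hnd hI₀ hcs
  have hR'l : (misses (Conf G H) I₀ R).length ≤ scale n k := length_misses_le.trans hRl
  obtain _ | ⟨x, cs⟩ := cs
  · have hpart := part_runs hM (conf_relRuns G H rev) hR'l hNl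
    obtain ⟨W₁, X₁, hrun₁, hb₁⟩ := h₁ (misses (Conf G H) (misses (Conf G H) I₀ R) N)
      (fun x hx => (mem_misses.1 hx).1) (nodup_misses hN)
    obtain ⟨W₂, X₂, hrun₂, hb₂⟩ := h₂ (misses (Conf G H) I₀ R)
      (fun x hx => (mem_misses.1 hx).1) (nodup_misses hR)
    have hX₁l := length_items_le_scale hb₁.nodup
    have hX₁ : ∀ x ∈ X₁, x ∈ N ∧ ∀ r ∈ misses (Conf G H) I₀ R, ¬ Conf G H r x := fun x hx =>
      mem_misses.1 (hb₁.subset x hx)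
    have hX₂ : ∀ x ∈ X₂, x ∈ misses (Conf G H) I₀ R := fun x hx => hb₂.subset x hx
    have hX₂R : ∀ x ∈ X₂, x ∈ R := fun x hx => (mem_misses.1 (hX₂ x hx)).1
    refine ⟨W₁ + W₂, X₁ ++ X₂, (Runs.casePair (.var rfl) (.casePair (.var rfl) (.casePair (.var rfl)
      (.caseNil (.var rfl) (.casePair (.var rfl) (.casePair (.var rfl) (.casePair
      (.call (.pair (.pair .nil .nil) (.pair (.var rfl) (.var rfl))) rfl hpart)
      (.call (.pair (.call (.pair (.var rfl) (.var rfl)) rfl hrun₁)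
        (.call (.pair (.var rfl) (.var rfl)) rfl hrun₂)) rfl
        (combine_runs W₁ W₂ X₁ X₂))))))))).mono ?_, ⟨?_, ?_, ⟨?_, ?_⟩, ?_⟩, ?_⟩
    · simp only [branchTime, List.length_nil, zero_add, one_pow, one_mul, mul_one]
      omega
    · intro x hx
      exact (List.mem_append.1 hx).imp (fun h => (hX₁ x h).1) fun h => hX₂R x h
    · exact List.nodup_append.2 ⟨hb₁.nodup, hb₂.nodup, fun x hx y hy h =>
        hNR x (hX₁ x hx).1 y (hX₂R y hy) (h ▸ rfl)⟩
    · intro x hx y hy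
      rcases List.mem_append.1 hx with hx | hx <;> rcases List.mem_append.1 hy with hy | hy
      · exact hb₁.valid.1 x hx y hy
      · exact fun h => (hX₁ x hx).2 y (hX₂ y hy) h.symm
      · exact (hX₁ y hy).2 x (hX₂ x hx)
      · exact hb₂.valid.1 x hx y hy
    · intro x hx y hy h
      rcases List.mem_append.1 hx with hx | hx <;> rcases List.mem_append.1 hy with hy | hy
      · exact hb₁.valid.2 x hx y hy h
      · exact absurd h (hNR x (hX₁ x hx).1 y (hX₂R y hy))
      · exact absurd h.symm (hNR y (hX₁ y hy).1 x (hX₂R x hx))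
      · exact hb₂.valid.2 x hx y hy h
    · rw [List.map_append, List.sum_append, hb₁.sum, hb₂.sum]
    · intro I hI hI' _ Y₁ Y₂ hY₁ hY₂ hv₁ hv₂
      have hII : ∀ x, x ∈ I ↔ x ∈ I₀ := fun x => ⟨fun h => by simpa using hI' x h, hI x⟩
      simp only [hII] at hY₁ hY₂
      refine add_le_add (hb₁.le Y₁ (fun y hy => mem_misses.2 ⟨(hY₁ y hy).1, fun r hr => ?_⟩) hv₁)
        (hb₂.le Y₂ (fun y hy => mem_misses.2 (hY₂ y hy)) hv₂)
      have hr := mem_misses.1 hr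
      exact (hY₁ y hy).2 r hr.1 hr.2
  · rw [List.cons_append, List.nodup_cons] at hnd
    obtain ⟨hx, hnd⟩ := hnd
    have hxI : x ∉ I₀ := fun h => hx (by simp [h])
    have hxN : x ∈ N := hcsN (by simp)
    have hcsN' : cs ⊆ N := fun y hy => hcsN (by simp [hy])
    have hlenI := length_items_le_scale (List.nodup_append.1 hnd).2.1
    have hlencs := length_items_le_scale (List.nodup_append.1 hnd).1
    obtain ⟨W, X, hrun, hsol, hle⟩ := ih cs.length (by simp) cs I₀ rfl hcsN' hnd hI₀
      fun y hy z hz => hcs y hy z (by simp [hz])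
    have hx1 : ([x] : List (Fin n × Fin k)).length ≤ scale n k := by
      simp only [List.length_singleton]
      omega
    have hpart := part_runs hM (conf_relRuns G H rev) hx1 hR'l
    have hprune := prune_runs (G := G) (H := H) (rev := rev) x (I₀.map (privates G H R I₀)) (by
      intro p hp
      obtain ⟨y, -, rfl⟩ := List.mem_map.1 hp
      exact (List.length_filter_le _ _).trans hRl)
    rw [List.length_map] at hprune
    have hpl : 2 * scale n k ^ 4 * (I₀.length + 1) ≤ 4 * (scale n k ^ 4 * scale n k) := by
      calc 2 * scale n k ^ 4 * (I₀.length + 1) ≤ 2 * scale n k ^ 4 * (scale n k + scale n k) := by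
            gcongr
            omega
        _ = _ := by ring
    have hskip : ∀ I : Finset (Fin n × Fin k), (∀ y ∈ I, y ∈ I₀ ∨ y ∈ x :: cs) → x ∉ I →
        ∀ y ∈ I, y ∈ I₀ ∨ y ∈ cs := fun I hI hxI y hy => (hI y hy).imp_right fun h =>
      (List.mem_cons.1 h).resolve_left fun h' => hxI (by rwa [← h'])
    have htime := branchTime_succ_left (scale n k ^ 6) (E₁ + E₂) cs.length (q - I₀.length)
    by_cases hP : hits (Conf G H) [x] (misses (Conf G H) I₀ R) = []
    · rw [hP] at hpart
      refine ⟨W, X, (Runs.casePair (.var rfl) (.casePair (.var rfl) (.casePair (.var rfl)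
        (.casePair (.var rfl) (.bind (.call (.pair (.var rfl) (.pair (.var rfl) (.pair (.var rfl)
          (.var rfl)))) rfl hrun) (.casePair (.call (.pair (.pair .nil .nil) (.pair (.pair (.var rfl)
          .nil) (.var rfl))) rfl hpart) (.caseNil (.var rfl) (.var rfl)))))))).mono ?_,
        hsol, fun I hI hI' hirr => ?_⟩
      · simp only [List.length_cons]
        omega
      · refine hle I hI (hskip I hI' fun hxmem => ?_) hirr
        -- A private neighbor of `x` with respect to `I ⊇ I₀` is not dominated by `I₀`, so skipping
        -- `x` loses no irredundant extension.
        obtain ⟨r, hr, hxr, hpr⟩ := hirr.private_nbr x hxmem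
        have : r ∈ hits (Conf G H) [x] (misses (Conf G H) I₀ R) := mem_hits.2
          ⟨mem_misses.2 ⟨hr, fun y hy => hpr y (hI y hy) fun h => hxI (h ▸ hy)⟩, x, by simp, hxr⟩
        simp [hP] at this
    obtain ⟨p, P, hPeq⟩ := List.exists_cons_of_ne_nil hP
    rw [hPeq] at hpart
    by_cases hL : ∀ p ∈ I₀.map (privates G H R I₀), misses (Conf G H) [x] p ≠ []
    swap
    · refine ⟨W, X, (Runs.casePair (.var rfl) (.casePair (.var rfl) (.casePair (.var rfl)
        (.casePair (.var rfl) (.bind (.call (.pair (.var rfl) (.pair (.var rfl) (.pair (.var rfl)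
          (.var rfl)))) rfl hrun) (.casePair (.call (.pair (.pair .nil .nil) (.pair (.pair (.var rfl)
          .nil) (.var rfl))) rfl hpart) (.casePair (.var rfl) (.caseNil (.call (.pair (.var rfl)
          (.var rfl)) rfl (hprune.2 hL)) (.var rfl))))))))).mono ?_,
        hsol, fun I hI hI' hirr => ?_⟩
      · simp only [List.length_cons]
        omega
      · refine hle I hI (hskip I hI' fun hxmem => hL ?_) hirr
        intro p hp
        obtain ⟨y, hy, rfl⟩ := List.mem_map.1 hp
        -- If `x` belonged to `I`, the private neighbor of `y` would survive the pruning by `x`.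
        obtain ⟨r, hr, hyr, hpr⟩ := hirr.private_nbr y (hI y hy)
        refine List.ne_nil_of_mem (mem_misses.2 ⟨mem_privates.2 ⟨hr, hyr,
          fun z hz => hpr z (hI z hz)⟩, ?_⟩ : r ∈ _)
        simpa using hpr x hxmem fun h => hxI (h ▸ hy)
    have hprune := hprune.1 hL
    have hirr' : IsIrredundant G H {x | x ∈ N} {x | x ∈ R} {y | y ∈ x :: I₀} := by
      refine ⟨?_, ?_, ?_⟩
      · intro y hy
        rcases List.mem_cons.1 hy with rfl | hy
        · exact hxN
        · exact hI₀.subset hy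
      · intro y hy z hz
        rcases List.mem_cons.1 hy with hy | hy <;> rcases List.mem_cons.1 hz with hz | hz
        · rw [hy, hz]
          exact not_conf_self _
        · rw [hy]
          exact fun h => hcs z hz x (by simp) h.symm
        · rw [hz]
          exact hcs y hy x (by simp)
        · exact hI₀.indep y hy z hz
      · intro y hy
        suffices privates G H R (x :: I₀) y ≠ [] by
          obtain ⟨r, hr⟩ := List.exists_mem_of_ne_nil _ this
          exact ⟨r, mem_privates.1 hr⟩
        rcases List.mem_cons.1 hy with rfl | hy
        · rwa [privates_cons_self hxI]
        · rw [privates_cons_of_mem hxI hy]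
          exact hL _ (List.mem_map_of_mem hy)
    have hpart' := part_runs hM (conf_relRuns G H rev) hx1 hlencs
    have hnd' : (misses (Conf G H) [x] cs ++ x :: I₀).Nodup := by
      have h : (x :: (cs ++ I₀)).Nodup := List.nodup_cons.2 ⟨hx, hnd⟩
      refine (List.perm_middle.nodup_iff.2 h).sublist (List.Sublist.append_right ?_ _)
      exact List.filter_sublist
    have hlen' := hq (x :: I₀) (List.nodup_append.1 hnd').2.1 hirr'
    obtain ⟨W', X', hrun', hsol', hle'⟩ := ih (misses (Conf G H) [x] cs).length
      (Nat.lt_succ_of_le length_misses_le) _ (x :: I₀) rfl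
      (fun y hy => hcsN' (mem_misses.1 hy).1) hnd' hirr' (by
        intro y hy z hz
        have hz := mem_misses.1 hz
        rcases List.mem_cons.1 hy with rfl | hy
        · exact hz.2 y (by simp)
        · exact hcs y hy z (by simp [hz.1]))
    have hmap : I₀.map (privates G H R (x :: I₀)) =
        (I₀.map (privates G H R I₀)).map (misses (Conf G H) [x]) := by
      rw [List.map_map]
      exact List.map_congr_left fun y hy => privates_cons_of_mem hxI hy
    rw [List.map_cons, hmap, privates_cons_self hxI, ← misses_cons, hPeq] at hrun'
    obtain ⟨W'', X'', hrun'', hor, hW, hW'⟩ := better_runs (G := G) (H := H) (rev := rev) W W' X X'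
    refine ⟨W'', X'', (Runs.casePair (.var rfl) (.casePair (.var rfl) (.casePair (.var rfl)
        (.casePair (.var rfl) (.bind (.call (.pair (.var rfl) (.pair (.var rfl) (.pair (.var rfl)
          (.var rfl)))) rfl hrun) (.casePair (.call (.pair (.pair .nil .nil) (.pair (.pair (.var rfl)
          .nil) (.var rfl))) rfl hpart) (.casePair (.var rfl) (.casePair (.call (.pair (.var rfl)
          (.var rfl)) rfl hprune) (.casePair (.call (.pair (.pair .nil .nil) (.pair (.pair (.var rfl)
          .nil) (.var rfl))) rfl hpart') (.call (.pair (.var rfl) (.call (.pair (.var rfl)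
          (.pair (.var rfl) (.pair (.pair (.var rfl) (.var rfl)) (.var rfl)))) rfl hrun'))
          rfl hrun'')))))))))).mono ?_, ?_, ?_⟩
    · have h1 := branchTime_mono (K := scale n k ^ 6) (E := E₁ + E₂)
        (q := q - (x :: I₀).length) (length_misses_le (r := Conf G H) (X := [x]) (U := cs))
      have h2 := branchTime_succ (scale n k ^ 6) (E₁ + E₂) cs.length (q - (x :: I₀).length)
      -- The subtraction does not truncate, since the irredundant set `x :: I₀` has at most `q`
      -- elements by `hlen'`.
      have h3 : q - (x :: I₀).length + 1 = q - I₀.length := by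
        simp only [List.length_cons] at *
        omega
      rw [h3] at h2
      simp only [List.length_cons] at *
      omega
    · rcases hor with ⟨rfl, rfl⟩ | ⟨rfl, rfl⟩
      · exact hsol
      · exact hsol'
    · intro I hI hI' hirr Y₁ Y₂ hY₁ hY₂ hv₁ hv₂
      by_cases hxmem : x ∈ I
      · refine (hle' I ?_ ?_ hirr Y₁ Y₂ hY₁ hY₂ hv₁ hv₂).trans hW'
        · intro y hy
          rcases List.mem_cons.1 hy with rfl | hy
          · exact hxmem
          · exact hI y hy
        · intro y hy
          rcases hI' y hy with h | h
          · exact Or.inl (by simp [h])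
          · rcases List.mem_cons.1 h with rfl | h
            · exact Or.inl (by simp)
            · exact Or.inr (mem_misses.2 ⟨h, by simpa using hirr.indep x hxmem y hy⟩)
      · exact (hle I hI (hskip I hI' hxmem) hirr Y₁ Y₂ hY₁ hY₂ hv₁ hv₂).trans hW

/-- A pivot multiplies the cost of its two subtrees by `(scale n k + 1) ^ q`, a split by nothing.
Costs of subtrees add up, so the exponent counts the pivots on a branch and the tree size enters
only linearly. -/
theorem solve_runs {q : ℕ} (hq : ∀ (w : Fin n) (N R I : List (Fin n × Fin k)),
      (∀ x ∈ N, G.Adj w x.1) → (∀ x ∈ R, ¬ G.Adj w x.1) → I.Nodup →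
      IsIrredundant G H {x | x ∈ N} {x | x ∈ R} {x | x ∈ I} → I.length ≤ q)
    {T : Dec (Fin n)} {A : Set (Fin n)} {d : ℕ} (hT : T.Ok G A d) :
    ∀ S : List (Fin n × Fin k), S.Nodup → (∀ x ∈ S, x.1 ∈ A) → ∃ W X,
      Runs (prog H) [.pair (encDec G T) (encL (encItem G H rev) S)] solveBody
        (encSol G H rev W X) ((scale n k + 1) ^ (q * d) * (scale n k ^ 8 * (2 * T.size + 1))) ∧
      IsBest G H rev {x | x ∈ S} W X := by
  have hM := hundred_le_scale n k
  have hM4 := pow_four_le n k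
  have hM8 : scale n k ^ 4 + 100 + scale n k ^ 6 * (scale n k + 1) ≤ scale n k ^ 8 := by
    have h1 : scale n k ^ 4 ≤ scale n k ^ 6 := Nat.pow_le_pow_right (by omega) (by omega)
    calc scale n k ^ 4 + 100 + scale n k ^ 6 * (scale n k + 1)
        ≤ scale n k ^ 6 * (scale n k + 3) := by linarith
      _ ≤ scale n k ^ 6 * (scale n k * scale n k) := by
          gcongr
          nlinarith
      _ = scale n k ^ 8 := by ring
  have hZ : ∀ e, 1 ≤ (scale n k + 1) ^ e := fun e => Nat.one_le_pow _ _ (by omega)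
  -- Both kinds of inner nodes are treated at once; `q'` bounds the irredundant sets across the cut.
  have key : ∀ {B : List (Fin n)} {l r : Dec (Fin n)} {A : Set (Fin n)} {q' e e' : ℕ}, B.Nodup →
      (∀ N R I : List (Fin n × Fin k), (∀ x ∈ N, x.1 ∈ A ∧ x.1 ∈ B) →
        (∀ x ∈ R, x.1 ∈ A ∧ x.1 ∉ B) → I.Nodup →
        IsIrredundant G H {x | x ∈ N} {x | x ∈ R} {x | x ∈ I} → I.length ≤ q') →
      (∀ S : List (Fin n × Fin k), S.Nodup → (∀ x ∈ S, x.1 ∈ {v ∈ A | v ∈ B}) → ∃ W X,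
        Runs (prog H) [.pair (encDec G l) (encL (encItem G H rev) S)] solveBody
          (encSol G H rev W X) ((scale n k + 1) ^ e * (scale n k ^ 8 * (2 * l.size + 1))) ∧
        IsBest G H rev {x | x ∈ S} W X) →
      (∀ S : List (Fin n × Fin k), S.Nodup → (∀ x ∈ S, x.1 ∈ {v ∈ A | v ∉ B}) → ∃ W X,
        Runs (prog H) [.pair (encDec G r) (encL (encItem G H rev) S)] solveBody
          (encSol G H rev W X) ((scale n k + 1) ^ e * (scale n k ^ 8 * (2 * r.size + 1))) ∧
        IsBest G H rev {x | x ∈ S} W X) → e' = q' + e →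
      ∀ S : List (Fin n × Fin k), S.Nodup → (∀ x ∈ S, x.1 ∈ A) → ∃ W X,
      Runs (prog H) [.pair (encDec G (.node B l r)) (encL (encItem G H rev) S)] solveBody
        (encSol G H rev W X)
        ((scale n k + 1) ^ e' * (scale n k ^ 8 * (2 * (Dec.node B l r).size + 1))) ∧
      IsBest G H rev {x | x ∈ S} W X := by
    rintro B l r A q' e _ hB hcut hl hr rfl S hS hSA
    have hBl := length_le_scale hB k
    have hSl := length_items_le_scale hS
    have hpart := part_runs hM (vert_item_relRuns G H rev) hBl hSl
    set N := hits (fun (v : Fin n) (x : Fin n × Fin k) => v = x.1) B S with hNdef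
    set R := misses (fun (v : Fin n) (x : Fin n × Fin k) => v = x.1) B S with hRdef
    have hN : ∀ x, x ∈ N ↔ x ∈ S ∧ x.1 ∈ B := fun x => by simp [hNdef, mem_hits]
    have hR : ∀ x, x ∈ R ↔ x ∈ S ∧ x.1 ∉ B := fun x => by
      rw [hRdef, mem_misses]
      exact and_congr_right fun _ =>
        ⟨fun h hx => h _ hx rfl, fun h v hv hvx => h (hvx ▸ hv)⟩
    have hNnd : N.Nodup := nodup_hits hS
    have hRnd : R.Nodup := nodup_misses hS
    have hNl := length_items_le_scale hNnd
    obtain ⟨W, X, hrun, hsol, hle⟩ := branch_runs (G := G) (H := H) (rev := rev) hNnd hRnd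
      (fun x hx y hy h => ((hR y).1 hy).2 (h ▸ ((hN x).1 hx).2))
      (hcut N R · (fun x hx => ⟨hSA x ((hN x).1 hx).1, ((hN x).1 hx).2⟩)
        (fun x hx => ⟨hSA x ((hR x).1 hx).1, ((hR x).1 hx).2⟩))
      (fun S' hS' hnd => hl S' hnd fun x hx =>
        ⟨hSA x ((hN x).1 (hS' hx)).1, ((hN x).1 (hS' hx)).2⟩)
      (fun S' hS' hnd => hr S' hnd fun x hx =>
        ⟨hSA x ((hR x).1 (hS' hx)).1, ((hR x).1 (hS' hx)).2⟩) N.length N [] rfl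
      (List.Subset.refl _) (by simpa using hNnd) ⟨by simp, by simp, by simp⟩ (by simp)
    have hR0 : misses (Conf G H) [] R = R := by simp [misses]
    rw [hR0] at hrun
    refine ⟨W, X, (Runs.casePair (.var rfl) (.casePair (.var rfl) (.casePair (.var rfl)
      (.casePair (.call (.pair (.pair (.pair .nil .nil) .nil) (.pair (.var rfl) (.var rfl))) rfl
        hpart) (.call (.pair (.pair (.var rfl) (.pair (.var rfl) (.var rfl))) (.pair (.var rfl)
        (.pair .nil (.var rfl)))) rfl hrun))))).mono ?_, ⟨⟨fun x hx => ?_, hsol.nodup, hsol.valid,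
        hsol.sum⟩, fun Y hYS hY => ?_⟩⟩
    · refine le_trans (b := scale n k ^ 4 + 100 + branchTime (scale n k ^ 6) ((scale n k + 1) ^ e *
        (scale n k ^ 8 * (2 * l.size + 1)) + (scale n k + 1) ^ e *
        (scale n k ^ 8 * (2 * r.size + 1))) (scale n k) q') ?_ ?_
      · have := branchTime_mono (K := scale n k ^ 6) (E := (scale n k + 1) ^ e *
          (scale n k ^ 8 * (2 * l.size + 1)) + (scale n k + 1) ^ e *
          (scale n k ^ 8 * (2 * r.size + 1))) (q := q') hNl
        simp only [List.length_nil, Nat.sub_zero]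
        omega
      · rw [branchTime, Dec.size, pow_add]
        have h1 := hZ q'
        have h2 := hZ e
        generalize (scale n k + 1) ^ q' = z at *
        generalize (scale n k + 1) ^ e = y at *
        calc scale n k ^ 4 + 100 + z * (scale n k ^ 6 * (scale n k + 1) +
              (y * (scale n k ^ 8 * (2 * l.size + 1)) + y * (scale n k ^ 8 * (2 * r.size + 1))))
            ≤ z * (scale n k ^ 4 + 100) + z * (scale n k ^ 6 * (scale n k + 1) +
              (y * (scale n k ^ 8 * (2 * l.size + 1)) + y * (scale n k ^ 8 * (2 * r.size + 1)))) := by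
              gcongr
              exact Nat.le_mul_of_pos_left _ h1
          _ = z * (scale n k ^ 4 + 100 + scale n k ^ 6 * (scale n k + 1)) +
              z * y * (scale n k ^ 8 * (2 * l.size + 2 * r.size + 2)) := by ring
          _ ≤ z * (y * scale n k ^ 8) +
              z * y * (scale n k ^ 8 * (2 * l.size + 2 * r.size + 2)) := by
              gcongr
              exact hM8.trans (Nat.le_mul_of_pos_left _ h2)
          _ = _ := by ring
    · exact (hsol.subset x hx).elim (fun h => ((hN x).1 h).1) fun h => ((hR x).1 h).1
    · classical
      -- For this `I`, an item of `R` in conflict with `Y ∩ N` is already in conflict with `I`, so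
      -- both halves of `Y` survive the filtering.
      obtain ⟨I, hIY, hI, hdom⟩ := exists_isIrredundant (G := G) (H := H) (N := {x | x ∈ N})
        (R := {x | x ∈ R}) (Y.filter (· ∈ N)) (by simp) fun x hx y hy =>
        hY.1 x (Finset.mem_filter.1 hx).1 y (Finset.mem_filter.1 hy).1
      have hIY' : ∀ x ∈ I, x ∈ Y ∧ x ∈ N := fun x hx => Finset.mem_filter.1 (hIY hx)
      have := hle I (by simp) (fun x hx => Or.inr (hIY' x hx).2) hI (Y.filter (· ∈ N))
        (Y.filter (¬ · ∈ N)) (fun x hx => ?_) (fun x hx => ?_) (hY.anti ?_) (hY.anti ?_)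
      · rwa [Finset.sum_filter_add_sum_filter_not] at this
      · obtain ⟨hxY, hxN⟩ := Finset.mem_filter.1 hx
        refine ⟨hxN, fun r hr hIr hrx => ?_⟩
        obtain ⟨y, hy, hyr⟩ := hdom r hr ⟨x, hx, hrx.symm⟩
        exact hIr y hy hyr
      · obtain ⟨hxY, hxN⟩ := Finset.mem_filter.1 hx
        refine ⟨(hR x).2 ⟨hYS x hxY, fun h => hxN ((hN x).2 ⟨hYS x hxY, h⟩)⟩, fun y hy => ?_⟩
        exact hY.1 y (hIY' y hy).1 x hxY
      · exact fun x hx => (Finset.mem_filter.1 hx).1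
      · exact fun x hx => (Finset.mem_filter.1 hx).1
  induction hT with
  | @leaf A d hA =>
    intro S hS hSA
    have hSl := length_items_le_scale hS
    obtain ⟨W, X, hrun, hb⟩ := best_runs_isBest (G := G) (H := H) (rev := rev) hA hSA
    refine ⟨W, X, (Runs.casePair (.var rfl) (.caseNil (.var rfl) (.call (.var rfl) rfl
      hrun))).mono ?_, hb⟩
    rw [Dec.size]
    have h1 := Nat.mul_le_mul_right (scale n k ^ 8 * (2 * 0 + 1)) (hZ (q * d))
    omega
  | @split B l r A d hB hno _ _ ih₁ ih₂ =>
    -- Without edges across there are no conflicts, hence no private neighbors and only the empty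
    -- `I`.
    refine key (q' := 0) hB (fun N R I hN hR _ hI => ?_) ih₁ ih₂ (by omega)
    by_contra! hlen
    obtain ⟨x, hx⟩ := List.exists_mem_of_length_pos hlen
    obtain ⟨y, hy, hxy, -⟩ := hI.private_nbr x hx
    have hx := hN x (hI.subset hx)
    exact hno x.1 hx.1 hx.2 y.1 (hR y hy).1 (hR y hy).2 hxy.1
  | @pivot B l r A d w hB hw _ _ ih₁ ih₂ =>
    refine key (q' := q) hB (fun N R I hN hR => hq w N R I
      (fun x hx => (hw _ (hN x hx).1).1 (hN x hx).2)
      fun x hx h => (hR x hx).2 ((hw _ (hR x hx).1).2 h)) ih₁ ih₂ (by ring)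

end Solve

/-! ### Input and output -/

section Main

variable {n k : ℕ} {G : SimpleGraph (Fin n)} {H : SimpleGraph (Fin k)}
  {rev : Fin n → Fin k → ℝ}

theorem drop_finRange {m i : ℕ} (h : i < m) :
    (List.finRange m).drop i = ⟨i, h⟩ :: (List.finRange m).drop (i + 1) := by
  rw [List.drop_eq_getElem_cons (by simpa using h)]
  simp

theorem drop_finRange_self (m : ℕ) : (List.finRange m).drop m = [] := by simp

theorem list_runs {α : Type*} {P : Program} {env : List Val} {t : α → Term} {v : α → Val} {B : ℕ}
    (h : ∀ a, Runs P env (t a) (v a) B) (l : List α) :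
    Runs P env (Term.list (l.map t)) (encodeList (l.map v)) ((B + 1) * l.length + 1) := by
  induction l with
  | nil => exact .nil
  | cons a l ih =>
    refine (Runs.pair (h a) ih).mono ?_
    simp only [List.length_cons]
    linarith

theorem ofProp_runs {P : Program} {env : List Val} (p : Prop) :
    Runs P env (Term.ofProp p) (encodeProp p) 3 := by
  by_cases hp : p
  · rw [Term.ofProp, if_pos hp]
    exact true_runs hp
  · rw [Term.ofProp, if_neg hp]
    exact (nil_runs hp).mono (by omega)

theorem colorRows_runs (H : SimpleGraph (Fin k)) {P : Program} {env : List Val} :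
    Runs P env (Term.list (List.ofFn fun a => Term.list (List.ofFn fun b =>
      Term.ofProp (¬ H.Adj a b)))) (encodeList ((List.finRange k).map (encColorRow H)))
      ((4 * k + 2) * k + 1) := by
  have := list_runs (P := P) (env := env) (v := encColorRow H) (B := 4 * k + 1)
    (t := fun a => Term.list (List.ofFn fun b => Term.ofProp (¬ H.Adj a b))) (fun a => by
      have := list_runs (P := P) (env := env) (fun b => ofProp_runs (¬ H.Adj a b))
        (List.finRange k)
      simpa only [encColorRow, List.ofFn_eq_map, List.length_finRange] using this)
    (List.finRange k)
  simpa only [List.ofFn_eq_map, List.length_finRange] using this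

theorem colors_runs (v : Fin n) (m : ℕ) : ∀ j, j + m = k →
    Runs (prog H) [.pair (.pair (encodeNat v) (encRow G v)) (.pair (encodeNat j)
      (.pair (encodeList (((List.finRange k).drop j).map fun a => .num (rev v a)))
        (encodeList (((List.finRange k).drop j).map (encColorRow H)))))] colorsBody
      (encL (encItem G H rev) (((List.finRange k).drop j).map fun a => (v, a)))
      (60 * (m + 1)) := by
  induction m with
  | zero =>
    intro j hj
    obtain rfl : j = k := by omega
    rw [drop_finRange_self]
    exact (Runs.casePair (.var rfl) (.casePair (.var rfl) (.casePair (.var rfl)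
      (.caseNil (.var rfl) .nil)))).mono (by omega)
  | succ m ih =>
    intro j hj
    rw [drop_finRange (by omega)]
    exact (Runs.casePair (.var rfl) (.casePair (.var rfl) (.casePair (.var rfl)
      (.casePair (.var rfl) (.casePair (.var rfl) (.pair (.pair (.var rfl) (.pair (.var rfl)
        (.pair (.var rfl) (.var rfl)))) (.call (.pair (.var rfl) (.pair (.pair .nil (.var rfl))
        (.pair (.var rfl) (.var rfl)))) rfl (ih (j + 1) (by omega))))))))).mono (by omega)

/-- The list of all pairs of a vertex in the list and a color. -/
def itemsOf (k : ℕ) (l : List (Fin n)) : List (Fin n × Fin k) :=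
  l.flatMap fun v => (List.finRange k).map fun a => (v, a)

theorem items_runs (m : ℕ) : ∀ i, i + m = n →
    Runs (prog H) [.pair (encodeNat i) (.pair
      (encodeList (((List.finRange n).drop i).map (encRow G)))
      (encodeList (((List.finRange n).drop i).map fun u =>
        encodeList ((List.finRange k).map fun a => .num (rev u a)))))] (itemsBody H)
      (encL (encItem G H rev) (itemsOf k ((List.finRange n).drop i)))
      (((4 * k + 2) * k + 200 * (k + 1)) * (m + 1)) := by
  induction m with
  | zero =>
    intro i hi
    obtain rfl : i = n := by omega
    rw [drop_finRange_self]
    exact (Runs.casePair (.var rfl) (.casePair (.var rfl) (.caseNil (.var rfl) .nil))).mono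
      (by simp only [zero_add, mul_one]; omega)
  | succ m ih =>
    intro i hi
    rw [drop_finRange (by omega)]
    have happ := append_runs (H := H) (encItem G H rev)
      ((List.finRange k).map fun a => ((⟨i, by omega⟩ : Fin n), a))
      (itemsOf k ((List.finRange n).drop (i + 1)))
    simp only [List.length_map, List.length_finRange] at happ
    refine (Runs.casePair (.var rfl) (.casePair (.var rfl) (.casePair (.var rfl)
      (.casePair (.var rfl) (.call (.pair (.call (.pair (.pair (.var rfl) (.var rfl)) (.pair .nil
        (.pair (.var rfl) (colorRows_runs H)))) rfl
          (colors_runs (G := G) (H := H) (rev := rev) ⟨i, by omega⟩ k 0 (by omega)))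
          (.call (.pair (.pair .nil (.var rfl)) (.pair (.var rfl) (.var rfl))) rfl
            (ih (i + 1) (by omega)))) rfl happ))))).mono ?_
    linarith

theorem verts_runs (m : ℕ) : ∀ i, i + m = n →
    Runs (prog H) [.pair (encodeNat i) (encodeList (((List.finRange n).drop i).map (encRow G)))]
      vertsBody (encL (encVert G) ((List.finRange n).drop i)) (40 * (m + 1)) := by
  induction m with
  | zero =>
    intro i hi
    obtain rfl : i = n := by omega
    rw [drop_finRange_self]
    exact (Runs.casePair (.var rfl) (.caseNil (.var rfl) .nil)).mono (by omega)
  | succ m ih =>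
    intro i hi
    rw [drop_finRange (by omega)]
    exact (Runs.casePair (.var rfl) (.casePair (.var rfl) (.pair (.pair (.pair (.var rfl)
      (.var rfl)) .nil) (.call (.pair (.pair .nil (.var rfl)) (.var rfl)) rfl
      (ih (i + 1) (by omega)))))).mono (by omega)

/-! ### From sets of pairs back to partial colorings. -/

/-- The partial coloring whose graph is `X`. -/
noncomputable def coloringOf (X : List (Fin n × Fin k)) (v : Fin n) : Option (Fin k) :=
  (hits (fun (u : Fin n) (x : Fin n × Fin k) => u = x.1) [v] X).head?.map Prod.snd

theorem coloringOf_eq_some {X : List (Fin n × Fin k)} (hX : IsValid G H {x | x ∈ X}) {v : Fin n}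
    {a : Fin k} : coloringOf X v = some a ↔ (v, a) ∈ X := by
  have hmem : ∀ x, x ∈ hits (fun (u : Fin n) (x : Fin n × Fin k) => u = x.1) [v] X ↔
      x ∈ X ∧ v = x.1 := fun x => by
    rw [mem_hits]
    simp only [List.mem_singleton, exists_eq_left]
  unfold coloringOf
  generalize hits (fun (u : Fin n) (x : Fin n × Fin k) => u = x.1) [v] X = l at hmem
  obtain _ | ⟨x, l⟩ := l
  · simpa using hmem (v, a)
  · obtain ⟨hx, rfl⟩ := (hmem x).1 (by simp)
    simp only [List.head?_cons, Option.map_some, Option.some.injEq]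
    exact ⟨fun h => h ▸ hx, fun h => congrArg Prod.snd (hX.2 x hx _ h rfl)⟩

theorem out_runs {X : List (Fin n × Fin k)} (hX : X.length ≤ scale n k) (A : List (Fin n)) :
    Runs (prog H) [.pair (encL (encVert G) A) (encL (encItem G H rev) X)] outBody
      (encL (fun v => encodeNat ((coloringOf X v).elim 0 fun a => (a : ℕ) + 1)) A)
      ((scale n k ^ 4 + 100) * (A.length + 1)) := by
  induction A with
  | nil =>
    exact (Runs.casePair (.var rfl) (.caseNil (.var rfl) .nil)).mono
      (by simp only [List.length_nil, zero_add, mul_one]; omega)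
  | cons v A ih =>
    have hM := hundred_le_scale n k
    have hpart := part_runs hM (vert_item_relRuns G H rev) (X := [v]) (U := X)
      (by simp only [List.length_singleton]; omega) hX
    rw [encL_cons (fun v => encodeNat ((coloringOf X v).elim 0 fun a => (a : ℕ) + 1))]
    refine (Runs.casePair (.var rfl) (.casePair (.var rfl) (.casePair (.call (.pair (.pair
      (.pair .nil .nil) .nil) (.pair (.pair (.var rfl) .nil) (.var rfl))) rfl hpart)
      (.pair (B := 20) ?_ (.call (.pair (.var rfl) (.var rfl)) rfl ih))))).mono ?_
    · unfold coloringOf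
      obtain _ | ⟨x, l⟩ := hits (fun (u : Fin n) (x : Fin n × Fin k) => u = x.1) [v] X
      · exact (Runs.caseNil (.var rfl) .nil).mono (by omega)
      · exact (Runs.casePair (.var rfl) (.casePair (.var rfl) (.casePair (.var rfl)
          (.pair .nil (.var rfl))))).mono (by omega)
    · simp only [List.length_cons]
      linarith

theorem revenue_eq_sum (φ : Fin n → Option (Fin k)) :
    revenue rev φ = ∑ x : Fin n × Fin k with φ x.1 = some x.2, rev x.1 x.2 := by
  rw [revenue, Finset.sum_filter, Fintype.sum_prod_type]
  refine Finset.sum_congr rfl fun u _ => ?_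
  rcases h : φ u with _ | a <;> simp [h]

theorem IsBest.isOptimum {S : Set (Fin n × Fin k)} (hS : ∀ x, x ∈ S) {W : ℝ}
    {X : List (Fin n × Fin k)} (h : IsBest G H rev S W X) :
    IsOptimum G H rev (coloringOf X) := by
  refine ⟨fun u v huv a b ha hb => ?_, fun ψ hψ => ?_⟩
  · by_contra hab
    exact h.valid.1 _ ((coloringOf_eq_some h.valid).1 ha) _ ((coloringOf_eq_some h.valid).1 hb)
      ⟨huv, hab⟩
  · have hW : revenue rev (coloringOf X) = W := by
      rw [revenue_eq_sum, h.sum, ← List.sum_toFinset _ h.nodup]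
      congr 1
      ext x
      simp [coloringOf_eq_some h.valid]
    rw [hW, revenue_eq_sum]
    refine h.le _ (fun y _ => hS y) ⟨fun x hx y hy hc => ?_, fun x hx y hy hxy => ?_⟩
    · replace hx := (Finset.mem_filter.1 hx).2
      replace hy := (Finset.mem_filter.1 hy).2
      exact hc.2 (hψ _ _ hc.1 _ _ hx hy)
    · replace hx := (Finset.mem_filter.1 hx).2
      replace hy := (Finset.mem_filter.1 hy).2
      rw [hxy, hy, Option.some.injEq] at hx
      exact Prod.ext hxy hx.symm

/-- The tree is built from the empty path with `s = G.cliqueNum`, so it has at most `4 *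
G.cliqueNum` pivots per branch; the summand `11` absorbs all polynomial overhead. -/
theorem prog_runs (hP : ¬ (SimpleGraph.pathGraph 6).IsIndContained G) {q : ℕ}
    (hq : ∀ (w : Fin n) (N R I : List (Fin n × Fin k)),
      (∀ x ∈ N, G.Adj w x.1) → (∀ x ∈ R, ¬ G.Adj w x.1) → I.Nodup →
      IsIrredundant G H {x | x ∈ N} {x | x ∈ R} {x | x ∈ I} → I.length ≤ q) :
    ∃ φ, Runs (prog H) [encodeInstance G rev] (.call 0 (.var 0)) (encodeColoring φ)
        ((scale n k + 1) ^ (q * (4 * G.cliqueNum) + 11)) ∧ IsOptimum G H rev φ := by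
  have hM := hundred_le_scale n k
  have hMn := le_scale n k
  have hverts := verts_runs (G := G) (H := H) n 0 (by omega)
  have hitems := items_runs (G := G) (H := H) (rev := rev) n 0 (by omega)
  rw [List.drop_zero] at hverts hitems
  obtain ⟨T, hbuild, hT, hsz₀, hsz⟩ := build_runs (H := H) hP _ G.cliqueNum [] (List.finRange n) []
    rfl (List.nodup_finRange n) .nil
    { clique := fun K _ hK => hK.card_le_cliqueNum
      anti := by simp
      path := by simp
      nil := fun _ => rfl
      reach := fun h => absurd rfl h
      length := by simp }
  have hsize : 2 * T.size + 1 ≤ scale n k := by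
    by_cases hn : List.finRange n = []
    · rw [hsz₀ hn]
      omega
    · have := hsz hn
      simp only [List.length_finRange, List.length_nil] at this
      omega
  obtain ⟨W, X, hsolve, hX⟩ := solve_runs (H := H) (rev := rev) hq hT
    (itemsOf k (List.finRange n)) (by
      refine List.nodup_flatMap.2 ⟨fun v _ => (List.nodup_finRange k).map fun a b h => by
        simpa using h, (List.nodup_finRange n).imp fun {u v} huv => ?_⟩
      simp only [Function.onFun, List.Disjoint, List.mem_map, List.mem_finRange, true_and]
      rintro _ ⟨a, rfl⟩ ⟨b, hb⟩
      exact huv (congrArg Prod.fst hb).symm) (by simp)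
  have hout := out_runs (G := G) (H := H) (rev := rev) (length_items_le_scale hX.nodup)
    (List.finRange n)
  refine ⟨coloringOf X, ?_, hX.isOptimum fun x => by simp [itemsOf]⟩
  have hinst : encodeInstance G rev = .pair (encodeList ((List.finRange n).map (encRow G)))
      (encodeList ((List.finRange n).map fun u =>
        encodeList ((List.finRange k).map fun a => .num (rev u a)))) := by
    simp only [encodeInstance, List.ofFn_eq_map]
    congr 3
    ext1 u
    rw [encRow, List.ofFn_eq_map]
  have hcol : encodeColoring (coloringOf X) =
      encL (fun v => encodeNat ((coloringOf X v).elim 0 fun a => (a : ℕ) + 1))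
        (List.finRange n) := by
    rw [encodeColoring, List.ofFn_eq_map]
    rfl
  rw [hinst, hcol]
  refine (Runs.call (.var rfl) rfl (.casePair (.var rfl) (.bind (.call (.pair .nil (.var rfl)) rfl
    hverts) (.casePair (.call (.pair (.call (.pair (.var rfl) .nil) rfl hbuild)
      (.call (.pair .nil (.pair (.var rfl) (.var rfl))) rfl hitems)) rfl hsolve)
      (.call (.pair (.var rfl) (.var rfl)) rfl hout))))).mono ?_
  simp only [List.length_finRange, List.length_nil, Nat.sub_zero]
  set Z := scale n k with hZ
  have hk : k + 1 ≤ Z := by omega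
  have hn : n + 1 ≤ Z := by omega
  have h1 : ((4 * k + 2) * k + 200 * (k + 1)) * (n + 1) ≤ 300 * Z ^ 3 := by
    calc ((4 * k + 2) * k + 200 * (k + 1)) * (n + 1)
        ≤ ((4 * Z + 2 * Z) * Z + 200 * (Z * Z)) * Z := by
          gcongr
          · omega
          · omega
          · omega
          · nlinarith
      _ = 206 * Z ^ 3 := by ring
      _ ≤ _ := by omega
  have h2 : Z ^ 7 * (2 * T.size + 1) ≤ Z ^ 8 := by
    calc _ ≤ Z ^ 7 * Z := by gcongr
      _ = _ := by ring
  have h3 : (Z + 1) ^ (q * (4 * G.cliqueNum)) * (Z ^ 8 * (2 * T.size + 1)) ≤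
      (Z + 1) ^ (q * (4 * G.cliqueNum)) * Z ^ 9 := by
    calc _ ≤ (Z + 1) ^ (q * (4 * G.cliqueNum)) * (Z ^ 8 * Z) := by gcongr
      _ = _ := by ring
  have h4 : (Z ^ 4 + 100) * (n + 1) ≤ 2 * Z ^ 5 := by
    calc _ ≤ (Z ^ 4 + Z ^ 4) * Z := by
          gcongr
          exact hM.trans (Nat.le_self_pow (by omega) _)
      _ = _ := by ring
  have h5 : 1 ≤ (Z + 1) ^ (q * (4 * G.cliqueNum)) := Nat.one_le_pow _ _ (by omega)
  have hp : ∀ i, Z ^ i * 100 ≤ Z ^ (i + 1) := fun i => by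
    rw [pow_succ]
    gcongr
  have p1 := hp 0
  have p2 := hp 1
  have p3 := hp 2
  have p4 := hp 3
  have p5 := hp 4
  have p6 := hp 5
  have p7 := hp 6
  have p8 := hp 7
  have p9 := hp 8
  have p10 := hp 9
  simp only [zero_add, pow_zero, pow_one, one_mul, Nat.reduceAdd] at p1 p2 p3 p4 p5 p6 p7 p8 p9 p10
  calc _ ≤ (Z + 1) ^ (q * (4 * G.cliqueNum)) * Z ^ 9 + Z ^ 9 := by omega
    _ ≤ (Z + 1) ^ (q * (4 * G.cliqueNum)) * Z ^ 9 +
        (Z + 1) ^ (q * (4 * G.cliqueNum)) * Z ^ 9 := by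
      gcongr
      exact Nat.le_mul_of_pos_left _ h5
    _ = (Z + 1) ^ (q * (4 * G.cliqueNum)) * (2 * Z ^ 9) := by ring
    _ ≤ (Z + 1) ^ (q * (4 * G.cliqueNum)) * (Z + 1) ^ 11 := by
      gcongr
      calc 2 * Z ^ 9 ≤ Z ^ 10 := by omega
        _ ≤ (Z + 1) ^ 10 := Nat.pow_le_pow_left (by omega) _
        _ ≤ (Z + 1) ^ 11 := Nat.pow_le_pow_right (by omega) (by omega)
    _ = _ := by rw [pow_add]

/-! ### The arithmetic of the time bound. -/

theorem two_mul_le_two_pow (m : ℕ) : 101 * (m + 1) + 1 ≤ 2 ^ (m + 8) := by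
  have : m + 1 ≤ 2 ^ m := Nat.lt_two_pow_self
  rw [pow_add]
  omega

/-- The time bound of the program is of the form `n ^ O(ω ^ (t + 1))`. -/
theorem exists_time_bound (k t : ℕ) : ∃ c : ℕ, ∀ n ω : ℕ, ω ≤ n → (n ≠ 0 → 1 ≤ ω) →
    (scale n k + 1) ^ (k ^ 2 * (t * ω ^ t + 1) * (4 * ω) + 11) ≤
      c * n ^ (c * ω ^ (t + 1)) + c := by
  set e := 4 * k ^ 2 * (t + 1) + 11 with he
  have hexp : ∀ ω, k ^ 2 * (t * ω ^ t + 1) * (4 * ω) + 11 ≤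
      4 * k ^ 2 * (t + 1) * ω ^ (t + 1) + 11 := fun ω => by
    have h : ω ≤ ω ^ (t + 1) := Nat.le_self_pow (by omega) ω
    calc k ^ 2 * (t * ω ^ t + 1) * (4 * ω) + 11 = 4 * k ^ 2 * (t * ω ^ (t + 1) + ω) + 11 := by ring
      _ ≤ 4 * k ^ 2 * (t * ω ^ (t + 1) + ω ^ (t + 1)) + 11 := by gcongr
      _ = _ := by ring
  -- The first summand serves `n ≥ 2`, where `scale n k + 1 ≤ n ^ (k + 10)`; the second bounds the
  -- whole running time for `n ≤ 1`.
  refine ⟨(k + 10) * e + (201 * (k + 1)) ^ e, fun n ω hω hω' => ?_⟩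
  rcases Nat.lt_or_ge n 2 with hn | hn
  · refine le_trans ?_ (Nat.le_add_left _ _)
    refine le_trans ?_ (Nat.le_add_left _ _)
    have h1 : scale n k + 1 ≤ 201 * (k + 1) := by
      have : n + 1 ≤ 2 := by omega
      unfold scale
      nlinarith [Nat.mul_le_mul_right (k + 1) this]
    have h2 : ω ^ (t + 1) ≤ 1 := pow_le_one' (by omega) _
    refine (Nat.pow_le_pow_left h1 _).trans (Nat.pow_le_pow_right (by omega) ?_)
    refine (hexp ω).trans ?_
    have := Nat.mul_le_mul_left (4 * k ^ 2 * (t + 1)) h2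
    omega
  · have h1 : scale n k + 1 ≤ n ^ (k + 10) := by
      calc scale n k + 1 ≤ (101 * (k + 1) + 1) * (n + 1) := by
            unfold scale
            nlinarith [Nat.zero_le (k * n)]
        _ ≤ 2 ^ (k + 8) * n ^ 2 := by
            gcongr
            · exact two_mul_le_two_pow k
            · nlinarith
        _ ≤ n ^ (k + 8) * n ^ 2 := by gcongr
        _ = n ^ (k + 10) := by rw [← pow_add]
    have h2 : 1 ≤ ω ^ (t + 1) := Nat.one_le_pow _ _ (hω' (by omega))
    have h3 : k ^ 2 * (t * ω ^ t + 1) * (4 * ω) + 11 ≤ e * ω ^ (t + 1) := by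
      refine (hexp ω).trans ?_
      rw [he, add_mul]
      omega
    have hc : 1 ≤ (k + 10) * e + (201 * (k + 1)) ^ e :=
      (Nat.one_le_pow _ _ (by omega)).trans (Nat.le_add_left _ _)
    generalize hC : (k + 10) * e + (201 * (k + 1)) ^ e = C at *
    calc (scale n k + 1) ^ (k ^ 2 * (t * ω ^ t + 1) * (4 * ω) + 11)
        ≤ (n ^ (k + 10)) ^ (e * ω ^ (t + 1)) := (Nat.pow_le_pow_left h1 _).trans
          (Nat.pow_le_pow_right (Nat.pos_of_ne_zero (by positivity)) h3)
      _ = n ^ ((k + 10) * e * ω ^ (t + 1)) := by rw [← pow_mul, mul_assoc]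
      _ ≤ n ^ (C * ω ^ (t + 1)) := by
          refine Nat.pow_le_pow_right (by omega) ?_
          gcongr
          omega
      _ ≤ C * n ^ (C * ω ^ (t + 1)) := Nat.le_mul_of_pos_left _ hc
      _ ≤ _ := Nat.le_add_right _ _

theorem exists_solves (H : SimpleGraph (Fin k)) (t : ℕ) : ∃ c : ℕ, Solves (prog H) H
    (fun {_n} G => ¬ (SimpleGraph.pathGraph 6).IsIndContained G ∧
      ¬ (subdividedStar (t + 1)).IsIndContained G)
    (fun {n} G => c * n ^ (c * G.cliqueNum ^ (t + 1)) + c) := by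
  obtain ⟨c, hc⟩ := exists_time_bound k t
  refine ⟨c, fun n G hG rev => ?_⟩
  obtain ⟨φ, ⟨T, hT, hrun⟩, hφ⟩ := prog_runs (G := G) (H := H) (rev := rev) hG.1
    (q := k ^ 2 * (t * G.cliqueNum ^ t + 1)) fun w N R I hN hR hnd hI => by
      have := IsIrredundant.card_le (I := I.toFinset) hG.2 (ω := G.cliqueNum)
        (fun K hK => hK.card_le_cliqueNum) (w := w) (N := {x | x ∈ N}) (R := {x | x ∈ R}) hN hR
        (by simpa using hI)
      rwa [List.toFinset_card_of_nodup hnd, Fintype.card_fin] at this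
  refine ⟨φ, T, hrun, hφ, hT.trans (hc n G.cliqueNum ?_ fun hn => ?_)⟩
  · obtain ⟨s, hs⟩ := G.exists_isNClique_cliqueNum
    rw [← hs.card_eq]
    simpa using Finset.card_le_univ s
  · have : G.IsClique (({⟨0, Nat.pos_of_ne_zero hn⟩} : Finset (Fin n)) : Set (Fin n)) := by simp
    simpa using this.card_le_cliqueNum

end Main

end MaxPartial

/-- For every fixed loopless pattern graph `H`: Max Partial `H`-Coloring is solvable in time
`n ^ O(ω(G) ^ t)` on `{P₆, S_t}`-free graphs for every fixed `t`, and in time `n ^ O(ω(G) ^ 3)` on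
`{P₆, 1-subdivided claw}`-free graphs. The additive constant only matters for `n ≤ 1`. -/
theorem mainTheorem4 {k : ℕ} (H : SimpleGraph (Fin k)) :
    (∀ t : ℕ, ∃ (P : MaxPartial.Program) (c : ℕ),
      MaxPartial.Solves P H
        (fun {_n} G => ¬ (SimpleGraph.pathGraph 6).IsIndContained G ∧
          ¬ (MaxPartial.subdividedStar t).IsIndContained G)
        (fun {n} G => c * n ^ (c * G.cliqueNum ^ t) + c)) ∧
    (∃ (P : MaxPartial.Program) (c : ℕ),
      MaxPartial.Solves P H
        (fun {_n} G => ¬ (SimpleGraph.pathGraph 6).IsIndContained G ∧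
          ¬ MaxPartial.subdividedClaw.IsIndContained G)
        (fun {n} G => c * n ^ (c * G.cliqueNum ^ 3) + c)) := by
  refine ⟨fun t => ⟨MaxPartial.prog H, ?_⟩, MaxPartial.prog H, ?_⟩
  · obtain _ | t := t
    -- `S_0` is a single vertex, so only the empty graph is in the class, and it is also `S_1`-free.
    -- The factor `2` covers `0 ^ 0 = 1` in the bound.
    · obtain ⟨c, hc⟩ := MaxPartial.exists_solves H 0
      refine ⟨2 * c, fun n G hG rev => ?_⟩
      obtain rfl : n = 0 := by
        by_contra hn
        refine hG.2 (MaxPartial.subdividedStar_isIndContained (w := ⟨0, Nat.pos_of_ne_zero hn⟩)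
          (x := Fin.elim0) (u := Fin.elim0) ?_ ?_ ?_ ?_ ?_ ?_) <;> exact fun i => i.elim0
      obtain ⟨φ, T, hrun, hφ, hT⟩ := hc 0 G ⟨hG.1, fun ⟨f⟩ => (f none).elim0⟩ rev
      refine ⟨φ, T, hrun, hφ, hT.trans (le_trans ?_ (Nat.le_add_left _ _))⟩
      have : 0 ^ (c * G.cliqueNum ^ (0 + 1)) ≤ 1 := pow_le_one' (by omega) _
      have := Nat.mul_le_mul_left c this
      beta_reduce
      omega
    · exact MaxPartial.exists_solves H t
  · obtain ⟨c, hc⟩ := MaxPartial.exists_solves H 2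
    exact ⟨c, fun n G hG => hc n G ⟨hG.1, fun h =>
      hG.2 (MaxPartial.subdividedClaw_isIndContained_subdividedStar.trans h)⟩⟩
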